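/- \textbf{Setting.} Let $\{X_t,\ t\in\mathbb{R}\}$ be a measurable real-valued process on a probability space $(\Omega,\mathcal F,P)$ such that all $X_t$ have the same density $f$ and, for all $s\neq t$, the pair $(X_s,X_t)$ has a joint density $f_{|t-s|}$ depending only on $|t-s|$. Put $g_u(y,z)=f_u(y,z)-f(y)f(z)$ for $u>0$, and $\alpha^{(2)}_X(u)=\sup_{t\in\mathbb{R}}\sup\{|P(A\cap B)-P(A)P(B)| : A\in\sigma(X_t),\ B\in\sigma(X_{t+u})\}$. The observations are $X_{t_1},\dots,X_{t_n}$, where the random times $(t_k)$ are independent of the process (that is, of a sub-$\sigma$-algebra $\mathcal G\subset\mathcal F$ such that $(t,\omega)\mapsto X_t(\omega)$ is $\mathcal B(\mathbb R)\otimes\mathcal G$-measurable) and follow one of two designs. (a) \emph{Renewal sampling}: $t_k=\sum_{j=1}^k\tau_j$, with $\tau_j$ i.i.d. positive with a density $g$, $g(t)>0$ for $t>0$, of finite mean, and whose renewal density $\sum_{k\ge1}g^{\star k}$ is bounded by a constant $h_0$. (b) \emph{Jittered sampling}: $t_k=k\delta+Z_k$, with $\delta>0$ and $Z_k$ i.i.d.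 with a symmetric density on $[-\delta/2,\delta/2]$. For a bin width $h_n>0$ and an arbitrary origin $a_n\in\mathbb R$ let $b_j=a_n+jh_n$, $c_j=(b_j+b_{j+1})/2$ and $\hat f_j=\frac1{nh_n}\#\{1\le k\le n: X_{t_k}\in[b_j,b_{j+1})\}$ for $j\in\mathbb{Z}$. The frequency polygon is $$\hat f_n^{FP}(x)=\frac{x-c_j}{h_n}\hat f_{j+1}+\frac{c_{j+1}-x}{h_n}\hat f_j,\qquad x\in[c_j,c_{j+1}),\ j\in\mathbb{Z}.$$ Let $\mathrm{IV}(\hat f_n^{FP})=\int_{\mathbb R}\mathrm{Var}(\hat f_n^{FP}(x))\,dx$, $\mathrm{MISE}(\hat f_n^{FP})=\mathrm E\int_{\mathbb R}(\hat f_n^{FP}(x)-f(x))^2dx$ and $R(\varphi)=\int_{\mathbb R}\varphi(x)^2dx$. \textbf{Theorem.} Assume that $f$ is continuous and bounded; that for some $u_0>0$ there is a positive, continuous, integrable function $k$ on $\mathbb R$ with $\sup_z|g_u(y,z)|\le k(y)$ for all $u\ge u_0$ and all $y$; that for some $\rho>2$, $a_0>0$, $u_1>u_0$ one has $\alpha_X^{(2)}(u)\le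 a_0u^{-\rho}$ for all $u\ge u_1$; and that $f^{1-1/p}\in C^1(\mathbb R)\cap L_1(\mathbb R)$ for some $1<p<\rho-1$. Let $C=2u_0h_0$ under design (a) and $C=2\lceil u_0/\delta\rceil$ under design (b). 1. If $h_n\to0^+$ and $nh_n\to\infty$, then $$\limsup_{n\to\infty} nh_n\,\mathrm{IV}(\hat f_n^{FP})\le \tfrac23+C.$$ 2. If in addition $f\in C^2(\mathbb R)$, $f''\in L_1(\mathbb R)$, $f,f''\in L_2(\mathbb R)$, and $|f''(x)-f''(y)|\le l_0|x-y|^\nu$ for all $x,y\in\mathbb R$, with some $l_0>0$ and $\nu\in(0,1]$, then for every $0<c<\infty$ the choice $h_n=cn^{-1/5}$ yields $$\limsup_{n\to\infty} n^{4/5}\,\mathrm{MISE}(\hat f_n^{FP})\le\frac{49}{2880}c^4R(f'')+\frac1c\Big(\frac23+C\Big).$$ -/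

import Mathlib

open MeasureTheory ProbabilityTheory Filter Topology
open scoped ENNReal

noncomputable section

namespace FreqPolygon

/-! ### The process -/

/-- All `X t` have the common density `f`, and for `s ≠ t` the pair `(X s, X t)` has the joint
density `f₂ |t - s|`, which depends on `|t - s|` only. -/
structure HasStationaryDensities {Ω : Type*} [MeasurableSpace Ω] (P : Measure Ω)
    (X : ℝ → Ω → ℝ) (f : ℝ → ℝ) (f₂ : ℝ → ℝ × ℝ → ℝ) : Prop where
  measurable_X : ∀ t, Measurable (X t)
  measurable_f : Measurable f
  nonneg_f : ∀ x, 0 ≤ f x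
  map_eq : ∀ t, P.map (X t) = volume.withDensity (fun x => ENNReal.ofReal (f x))
  measurable_f₂ : ∀ u, 0 < u → Measurable (f₂ u)
  nonneg_f₂ : ∀ u, 0 < u → ∀ q, 0 ≤ f₂ u q
  map_pair_eq : ∀ s t, s ≠ t → P.map (fun ω => (X s ω, X t ω)) =
    (volume : Measure (ℝ × ℝ)).withDensity (fun q => ENNReal.ofReal (f₂ |t - s| q))

/-- `g_u = f_u - f ⊗ f`. -/
def pairDiff (f : ℝ → ℝ) (f₂ : ℝ → ℝ × ℝ → ℝ) (u y z : ℝ) : ℝ := f₂ u (y, z) - f y * f z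

/-- The strong mixing coefficient `sup |P(A ∩ B) - P(A) P(B)|` over `A ∈ 𝒜`, `B ∈ ℬ`. -/
def alphaCoeff {Ω : Type*} [MeasurableSpace Ω] (P : Measure Ω) (𝒜 ℬ : MeasurableSpace Ω) : ℝ :=
  ⨆ (A : {A : Set Ω // MeasurableSet[𝒜] A}) (B : {B : Set Ω // MeasurableSet[ℬ] B}),
    |P.real (A.1 ∩ B.1) - P.real A.1 * P.real B.1|

/-- `sup_t α(σ(X t), σ(X (t + u)))`. -/
def alphaTwo {Ω : Type*} [MeasurableSpace Ω] (P : Measure Ω) (X : ℝ → Ω → ℝ) (u : ℝ) : ℝ :=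
  ⨆ t : ℝ, alphaCoeff P (MeasurableSpace.comap (X t) inferInstance)
    (MeasurableSpace.comap (X (t + u)) inferInstance)

/-- For all lags `u ≥ u₀`, `sup_z |g_u(y, z)| ≤ k(y)` with `k` positive, continuous, integrable. -/
def PairDensityBound (f : ℝ → ℝ) (f₂ : ℝ → ℝ × ℝ → ℝ) (u₀ : ℝ) : Prop :=
  ∃ k : ℝ → ℝ, (∀ y, 0 < k y) ∧ Continuous k ∧ Integrable k ∧
    ∀ u, u₀ ≤ u → ∀ y z, |pairDiff f f₂ u y z| ≤ k y

/-- Arithmetic strong mixing (of pairs) with exponent `ρ`, from some lag `u₁ > u₀` on. -/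
def ArithmeticallyMixing {Ω : Type*} [MeasurableSpace Ω] (P : Measure Ω) (X : ℝ → Ω → ℝ)
    (u₀ ρ : ℝ) : Prop :=
  ∃ a₀ u₁ : ℝ, 0 < a₀ ∧ u₀ < u₁ ∧ ∀ u, u₁ ≤ u → alphaTwo P X u ≤ a₀ * u ^ (-ρ)

/-! ### The sampling times -/

/-- The process and the times are independent. Since the process is evaluated at random times,
this is asked of a σ-algebra `𝒢` that makes `(t, ω) ↦ X t ω` jointly measurable (so that `X`, as
a measurable process, is carried by `𝒢`). -/
def IndependentTimes {Ω : Type*} [mΩ : MeasurableSpace Ω] (P : Measure Ω)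
    (X : ℝ → Ω → ℝ) (t : ℕ → Ω → ℝ) : Prop :=
  ∃ 𝒢 : MeasurableSpace Ω, 𝒢 ≤ mΩ ∧
    Measurable[MeasurableSpace.prod (inferInstance : MeasurableSpace ℝ) 𝒢] (Function.uncurry X) ∧
    Indep 𝒢 (⨆ k, MeasurableSpace.comap (t k) inferInstance) P

/-- `t k` is the sum of the first `k` of a sequence of i.i.d. positive random variables with
density `g`, positive on `(0, ∞)` and of finite mean. -/
structure IsRenewalSampling {Ω : Type*} [MeasurableSpace Ω] (P : Measure Ω)
    (t : ℕ → Ω → ℝ) (g : ℝ → ℝ) : Prop where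
  measurable_g : Measurable g
  pos_g : ∀ s, 0 < s → 0 < g s
  nonneg_g : ∀ s, 0 ≤ g s
  support_g : ∀ s, s < 0 → g s = 0
  finite_mean : Integrable (fun s => s * g s)
  exists_increments : ∃ τ : ℕ → Ω → ℝ,
    (∀ k, Measurable (τ k)) ∧ iIndepFun τ P ∧
    (∀ k, P.map (τ k) = volume.withDensity (fun s => ENNReal.ofReal (g s))) ∧
    ∀ k ω, t k ω = ∑ i ∈ Finset.range k, τ i ω

/-- `convPow g k` is the `(k + 1)`-fold convolution of `g` with itself. -/
def convPow (g : ℝ → ℝ) : ℕ → ℝ → ℝ≥0∞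
  | 0 => fun s => ENNReal.ofReal (g s)
  | k + 1 => lconvolution (convPow g k) (fun s => ENNReal.ofReal (g s)) volume

/-- The renewal density: the sum of all the `k`-fold convolutions of `g`, `k ≥ 1`. -/
def renewalDensity (g : ℝ → ℝ) (s : ℝ) : ℝ≥0∞ := ∑' k : ℕ, convPow g k s

/-- `t k = k δ + Z k` with `Z` i.i.d. of symmetric density `gJ` on `[-δ/2, δ/2]`. -/
structure IsJitteredSampling {Ω : Type*} [MeasurableSpace Ω] (P : Measure Ω)
    (t : ℕ → Ω → ℝ) (δ : ℝ) (gJ : ℝ → ℝ) : Prop where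
  pos_δ : 0 < δ
  measurable_gJ : Measurable gJ
  nonneg_gJ : ∀ z, 0 ≤ gJ z
  symm_gJ : ∀ z, gJ (-z) = gJ z
  support_gJ : ∀ z, δ / 2 < |z| → gJ z = 0
  exists_noise : ∃ Z : ℕ → Ω → ℝ,
    (∀ k, Measurable (Z k)) ∧ iIndepFun Z P ∧
    (∀ k, P.map (Z k) = volume.withDensity (fun z => ENNReal.ofReal (gJ z))) ∧
    ∀ k ω, t k ω = k * δ + Z k ω

/-- `C` is the constant of the sampling design: `2 u₀ h₀` for a renewal sampling whose renewal
density is bounded by `h₀`, and `2 ⌈u₀ / δ⌉` for a jittered sampling of period `δ`. -/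
def IsDesignConstant {Ω : Type*} [MeasurableSpace Ω] (P : Measure Ω)
    (t : ℕ → Ω → ℝ) (u₀ C : ℝ) : Prop :=
  (∃ (g : ℝ → ℝ) (h₀ : ℝ), IsRenewalSampling P t g ∧
      (∀ s, renewalDensity g s ≤ ENNReal.ofReal h₀) ∧ C = 2 * u₀ * h₀) ∨
  (∃ (δ : ℝ) (gJ : ℝ → ℝ), IsJitteredSampling P t δ gJ ∧ C = 2 * (⌈u₀ / δ⌉ : ℝ))

/-! ### The estimator -/

/-- Left end point of the bin number `j`, for bin width `h` and origin `a`. -/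
def binLeft (a h : ℝ) (j : ℤ) : ℝ := a + j * h

/-- Midpoint of the bin number `j`. -/
def binMid (a h : ℝ) (j : ℤ) : ℝ := (binLeft a h j + binLeft a h (j + 1)) / 2

/-- Height of the histogram of the sample `y 1, …, y n` over the bin number `j`. -/
def histHeight (a h : ℝ) (n : ℕ) (y : ℕ → ℝ) (j : ℤ) : ℝ :=
  1 / (n * h) * ∑ k ∈ Finset.Icc 1 n,
    (Set.Ico (binLeft a h j) (binLeft a h (j + 1))).indicator (fun _ => (1 : ℝ)) (y k)

/-- The frequency polygon: the linear interpolant of the histogram heights at the midpoints. -/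
def freqPoly (a h : ℝ) (n : ℕ) (y : ℕ → ℝ) (x : ℝ) : ℝ :=
  ∑' j : ℤ, (Set.Ico (binMid a h j) (binMid a h (j + 1))).indicator
    (fun x => (x - binMid a h j) / h * histHeight a h n y (j + 1) +
      (binMid a h (j + 1) - x) / h * histHeight a h n y j) x

/-- The frequency polygon of the observations `X_{t 1}, …, X_{t n}`. -/
def estimator {Ω : Type*} (X : ℝ → Ω → ℝ) (t : ℕ → Ω → ℝ) (a h : ℝ) (n : ℕ) (ω : Ω) (x : ℝ) : ℝ :=
  freqPoly a h n (fun k => X (t k ω) ω) x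

/-- Integrated variance of a random function `F`. -/
def intVar {Ω : Type*} [MeasurableSpace Ω] (P : Measure Ω) (F : Ω → ℝ → ℝ) : ℝ≥0∞ :=
  ∫⁻ x, evariance (fun ω => F ω x) P

/-- Mean integrated squared error of `F` as an estimator of `f`. -/
def mise {Ω : Type*} [MeasurableSpace Ω] (P : Measure Ω) (F : Ω → ℝ → ℝ) (f : ℝ → ℝ) : ℝ≥0∞ :=
  ∫⁻ ω, (∫⁻ x : ℝ, ENNReal.ofReal ((F ω x - f x) ^ 2)) ∂P

/-- The roughness `∫ φ²`. -/
def roughness (φ : ℝ → ℝ) : ℝ := ∫ x, φ x ^ 2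

end FreqPolygon

end

/-! The frequency polygon is a kernel estimator: an observation `y` contributes to the estimate at
`x` the tent of half-width `h` centred at the midpoint of the bin of `y` (`polyKernel`,
`freqPoly_eq`). By independence of the times, the integrated variance is governed by a double sum
over `k, l` of expectations of a function of the two times: the integral over `x` of the covariance
of the tents of `X s` and `X u`, evaluated at `s = t k`, `u = t l`.

That integral is bounded in three ways. It never exceeds `2 h / 3`, the squared norm of a tent
(`lintegral_kernelCov_le`); this is used on the diagonal, which yields the term `2/3`, and for lags
below `u₀`, whose expected number around a given time is at most `C`. For lags `u ≥ u₀` it is at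
most `4 h ^ 2 ∫ k` by the density bound (`lintegral_kernelCov_le_density`) and at most `16 h α(u)`
by mixing (`lintegral_kernelCov_le_alphaTwo`). The point of the last bound is that it does not grow
with the number of bins: a choice of signs turns the sum of `|P(A j ∩ B j) - P(A j) P(B j)|` along
disjoint families into four deviations of unions (`sum_abs_dep_le`). After division by `h`, the
minimum of the last two bounds tends to `0` pointwise in the lag, and it is dominated by a function
integrable against the lag measure, which has linear growth, because `ρ > 2`. So the lags beyond
`u₀` contribute nothing in the limit (`tendsto_lintegral_lagBound`).

For the bias, the mean of the estimator on a cell interpolates bin averages of `f` linearly. On a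
quadratic with second derivative `m` the error is exactly `h ^ 2 (1/24 + θ (1 - θ) / 2) m`, where
`θ` is the relative position in the cell, and `49/2880` is the integral of the squared profile over
`[0, 1]`. Taking for `m` the mean of `f''` over the cell, Jensen's inequality sums the main terms to
`49/2880 h ^ 4 R(f'')`. The remainder is small by the Hölder condition and summable over the cells
because `f''` is integrable. -/

namespace FreqPolygon

/-! ### The frequency polygon as a kernel estimator -/

/-- The weight of an observation `y` in the frequency polygon at `x`: the tent function of width
`h` centred at the midpoint of the bin of `y`. -/
noncomputable def polyKernel (a h x y : ℝ) : ℝ :=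
  max 0 (1 - |x - binMid a h ⌊(y - a) / h⌋| / h)

/-- The bin number `j`. -/
def bin (a h : ℝ) (j : ℤ) : Set ℝ := Set.Ico (binLeft a h j) (binLeft a h (j + 1))

/-- The interval between the midpoints of the bins `j` and `j + 1`. -/
def cell (a h : ℝ) (j : ℤ) : Set ℝ := Set.Ico (binMid a h j) (binMid a h (j + 1))

lemma binMid_eq (a h : ℝ) (j : ℤ) : binMid a h j = a + (j + 1 / 2) * h := by
  simp only [binMid, binLeft]; push_cast; ring

lemma mem_bin_iff {a h : ℝ} (hh : 0 < h) {j : ℤ} {y : ℝ} :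
    y ∈ bin a h j ↔ ⌊(y - a) / h⌋ = j := by
  rw [Int.floor_eq_iff, le_div_iff₀ hh, div_lt_iff₀ hh, bin, Set.mem_Ico, binLeft, binLeft]
  push_cast
  constructor <;> rintro ⟨h1, h2⟩ <;> constructor <;> linarith

lemma mem_cell_iff {a h : ℝ} (hh : 0 < h) {j : ℤ} {x : ℝ} :
    x ∈ cell a h j ↔ ⌊(x - binMid a h 0) / h⌋ = j := by
  rw [Int.floor_eq_iff, le_div_iff₀ hh, div_lt_iff₀ hh, cell, Set.mem_Ico]
  simp only [binMid_eq]
  push_cast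
  constructor <;> rintro ⟨h1, h2⟩ <;> constructor <;> linarith

lemma pairwise_disjoint_bin {a h : ℝ} (hh : 0 < h) :
    Pairwise (Function.onFun Disjoint (bin a h)) := by
  intro i j hij
  refine Set.disjoint_left.2 fun y hi hj => hij ?_
  rw [mem_bin_iff hh] at hi hj
  exact hi.symm.trans hj

lemma pairwise_disjoint_cell {a h : ℝ} (hh : 0 < h) :
    Pairwise (Function.onFun Disjoint (cell a h)) := by
  intro i j hij
  refine Set.disjoint_left.2 fun y hi hj => hij ?_
  rw [mem_cell_iff hh] at hi hj
  exact hi.symm.trans hj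

lemma iUnion_cell {a h : ℝ} (hh : 0 < h) : ⋃ j, cell a h j = Set.univ := by
  refine Set.eq_univ_of_forall fun x => Set.mem_iUnion.2 ⟨_, (mem_cell_iff hh).2 rfl⟩

lemma measurableSet_bin (a h : ℝ) (j : ℤ) : MeasurableSet (bin a h j) := measurableSet_Ico

lemma measurableSet_cell (a h : ℝ) (j : ℤ) : MeasurableSet (cell a h j) := measurableSet_Ico

lemma volume_bin {a h : ℝ} (j : ℤ) : volume (bin a h j) = ENNReal.ofReal h := by
  rw [bin, Real.volume_Ico, binLeft, binLeft]; congr 1; push_cast; ring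

lemma volume_cell {a h : ℝ} (j : ℤ) : volume (cell a h j) = ENNReal.ofReal h := by
  rw [cell, Real.volume_Ico, binMid_eq, binMid_eq]; congr 1; push_cast; ring

lemma lintegral_eq_tsum_cell {a h : ℝ} (hh : 0 < h) (G : ℝ → ℝ≥0∞) :
    ∫⁻ x, G x = ∑' j, ∫⁻ x in cell a h j, G x := by
  rw [← lintegral_iUnion (measurableSet_cell a h) (pairwise_disjoint_cell hh), iUnion_cell hh,
    Measure.restrict_univ]

lemma polyKernel_nonneg (a h x y : ℝ) : 0 ≤ polyKernel a h x y := le_max_left _ _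

lemma polyKernel_le_one {a h : ℝ} (hh : 0 < h) (x y : ℝ) : polyKernel a h x y ≤ 1 := by
  refine max_le zero_le_one ?_
  have : 0 ≤ |x - binMid a h ⌊(y - a) / h⌋| / h := by positivity
  linarith

lemma measurable_polyKernel (a h : ℝ) : Measurable (fun q : ℝ × ℝ => polyKernel a h q.1 q.2) := by
  have hfl : Measurable (fun q : ℝ × ℝ => ((⌊(q.2 - a) / h⌋ : ℤ) : ℝ)) := by
    have : Measurable (fun q : ℝ × ℝ => ⌊(q.2 - a) / h⌋) :=
      Int.measurable_floor.comp ((measurable_snd.sub_const a).div_const h)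
    exact (measurable_from_top (f := fun i : ℤ => (i : ℝ))).comp this
  simp only [polyKernel, binMid_eq]
  fun_prop

/-- Only the midpoints `j` and `j + 1` can be at distance less than `h` from a point of the cell
`j`, and the values there of the two tents are the linear interpolation weights. -/
lemma polyKernel_of_mem_cell {a h : ℝ} (hh : 0 < h) {j : ℤ} {x : ℝ} (hx : x ∈ cell a h j) (y : ℝ) :
    polyKernel a h x y = (binMid a h (j + 1) - x) / h * (bin a h j).indicator (fun _ => 1) y +
      (x - binMid a h j) / h * (bin a h (j + 1)).indicator (fun _ => 1) y := by
  obtain ⟨h1, h2⟩ := hx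
  set i := ⌊(y - a) / h⌋ with hi
  have ind : ∀ l, (bin a h l).indicator (fun _ => (1 : ℝ)) y = if i = l then 1 else 0 := by
    intro l
    classical
    simp only [Set.indicator_apply, mem_bin_iff hh, hi]
  rw [ind, ind, polyKernel, ← hi]
  have key : (binMid a h (j + 1) - x) / h = 1 - (x - binMid a h j) / h := by
    field_simp; simp only [binMid_eq]; push_cast; ring
  rw [binMid_eq] at h1 h2
  push_cast at h2
  rcases lt_trichotomy i j with hij | rfl | hij
  · have hij' : (i : ℝ) + 1 ≤ j := by exact_mod_cast hij
    rw [if_neg (by omega), if_neg (by omega)]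
    rw [max_eq_left]
    · ring
    have : h ≤ |x - binMid a h i| := by
      refine le_trans ?_ (le_abs_self _)
      rw [binMid_eq]; nlinarith
    have := (one_le_div hh).2 this
    linarith
  · rw [if_pos rfl, if_neg (by omega), abs_of_nonneg (by rw [binMid_eq]; linarith), key,
      max_eq_right]
    · ring
    · rw [sub_nonneg, div_le_one hh, binMid_eq]; linarith
  · rcases eq_or_lt_of_le (Int.add_one_le_iff.2 hij) with hij2 | hij2
    · rw [if_neg (by omega), if_pos hij2.symm, ← hij2, abs_of_nonpos
        (by rw [binMid_eq]; push_cast; linarith), neg_sub, key, max_eq_right]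
      · ring
      · rw [sub_sub_cancel]
        refine div_nonneg ?_ hh.le
        rw [binMid_eq]; linarith
    · have hij' : (j : ℝ) + 2 ≤ i := by exact_mod_cast (by omega : j + 2 ≤ i)
      rw [if_neg (by omega), if_neg (by omega), max_eq_left]
      · ring
      have : h ≤ |x - binMid a h i| := by
        refine le_trans ?_ (neg_le_abs _)
        rw [binMid_eq]; nlinarith
      have := (one_le_div hh).2 this
      linarith

lemma freqPoly_eq {a h : ℝ} (hh : 0 < h) (n : ℕ) (y : ℕ → ℝ) (x : ℝ) :
    freqPoly a h n y x = 1 / (n * h) * ∑ k ∈ Finset.Icc 1 n, polyKernel a h x (y k) := by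
  set j := ⌊(x - binMid a h 0) / h⌋ with hj
  have hx : x ∈ cell a h j := (mem_cell_iff hh).2 rfl
  rw [freqPoly, tsum_eq_single j]
  · rw [Set.indicator_of_mem (by exact hx)]
    simp_rw [polyKernel_of_mem_cell hh hx, Finset.sum_add_distrib, ← Finset.mul_sum]
    simp only [histHeight, bin]
    ring
  · intro i hi
    refine Set.indicator_of_notMem (fun h' => hi ?_) _
    exact ((mem_cell_iff hh).1 h').symm

/-- The tent function has squared integral `2 h / 3`. -/
lemma lintegral_polyKernel_sq {a h : ℝ} (hh : 0 < h) (y : ℝ) :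
    ∫⁻ x, ENNReal.ofReal (polyKernel a h x y ^ 2) = ENNReal.ofReal (2 / 3 * h) := by
  set c := binMid a h ⌊(y - a) / h⌋ with hc
  have e : ∀ x, polyKernel a h x y ^ 2 =
      (Set.Icc (c - h) (c + h)).indicator (fun x => (1 - |x - c| / h) ^ 2) x := by
    intro x
    rw [polyKernel, ← hc, Set.indicator_apply]
    split_ifs with hx
    · rw [max_eq_right]
      rw [sub_nonneg, div_le_one hh, abs_le]
      constructor <;> linarith [hx.1, hx.2]
    · rw [max_eq_left]
      · ring
      have : h ≤ |x - c| := by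
        by_contra! h'
        rw [abs_lt] at h'
        exact hx ⟨by linarith [h'.1], by linarith [h'.2]⟩
      have := (one_le_div hh).2 this
      linarith
  have hcont : Continuous (fun x => (1 - |x - c| / h) ^ 2) := by fun_prop
  have hint : IntegrableOn (fun x => (1 - |x - c| / h) ^ 2) (Set.Icc (c - h) (c + h)) :=
    hcont.continuousOn.integrableOn_Icc
  simp_rw [e]
  rw [← ofReal_integral_eq_lintegral_ofReal (hint.integrable_indicator measurableSet_Icc)
    (ae_of_all _ fun x => Set.indicator_nonneg (fun _ _ => sq_nonneg _) x),
    integral_indicator measurableSet_Icc, integral_Icc_eq_integral_Ioc,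
    ← intervalIntegral.integral_of_le (by linarith)]
  congr 1
  rw [intervalIntegral.integral_comp_sub_right (fun x => (1 - |x| / h) ^ 2),
    ← intervalIntegral.integral_add_adjacent_intervals (b := 0)
      (Continuous.intervalIntegrable (by fun_prop) _ _)
      (Continuous.intervalIntegrable (by fun_prop) _ _)]
  have i1 : ∫ x in (c - h - c)..0, (1 - |x| / h) ^ 2 = ∫ x in (-h)..0, (1 + x / h) ^ 2 := by
    rw [show c - h - c = -h by ring]
    refine intervalIntegral.integral_congr fun x hx => ?_
    rw [Set.uIcc_of_le (by linarith)] at hx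
    rw [abs_of_nonpos hx.2]; ring
  have i2 : ∫ x in (0)..(c + h - c), (1 - |x| / h) ^ 2 = ∫ x in (0)..h, (1 - x / h) ^ 2 := by
    rw [show c + h - c = h by ring]
    refine intervalIntegral.integral_congr fun x hx => ?_
    rw [Set.uIcc_of_le (by linarith)] at hx
    rw [abs_of_nonneg hx.1]
  have d1 : ∫ x in (-h)..0, (1 + x / h) ^ 2 = h / 3 := by
    rw [intervalIntegral.integral_eq_sub_of_hasDerivAt (f := fun x => h / 3 * (1 + x / h) ^ 3)]
    · field_simp; ring
    · intro x _
      have := ((((hasDerivAt_id x).div_const h).const_add 1).pow 3).const_mul (h / 3)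
      convert! this using 1
      simp only [id, Nat.cast_ofNat, Nat.add_one_sub_one]
      field_simp
    · exact Continuous.intervalIntegrable (by fun_prop) _ _
  have d2 : ∫ x in (0)..h, (1 - x / h) ^ 2 = h / 3 := by
    rw [intervalIntegral.integral_eq_sub_of_hasDerivAt (f := fun x => -(h / 3) * (1 - x / h) ^ 3)]
    · field_simp; ring
    · intro x _
      have := ((((hasDerivAt_id x).div_const h).const_sub 1).pow 3).const_mul (-(h / 3))
      convert! this using 1
      simp only [id, Nat.cast_ofNat, Nat.add_one_sub_one]
      field_simp
    · exact Continuous.intervalIntegrable (by fun_prop) _ _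
  rw [i1, i2, d1, d2]; ring

/-! ### Strong mixing and families of disjoint events -/

/-- The deviation from independence of two events. -/
noncomputable def dep {Ω : Type*} [MeasurableSpace Ω] (P : Measure Ω) (A B : Set Ω) : ℝ :=
  P.real (A ∩ B) - P.real A * P.real B

/-- The diagonal sum of a matrix is at most the value of its quadratic form at some signs. -/
lemma exists_signs_sum_diag_le {ι : Type*} (J : Finset ι) (c : ι → ι → ℝ) :
    ∃ e : ι → ℝ, (∀ j, e j = 1 ∨ e j = -1) ∧
      ∑ j ∈ J, c j j ≤ ∑ j ∈ J, ∑ l ∈ J, c j l * (e j * e l) := by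
  classical
  induction J using Finset.induction_on with
  | empty => exact ⟨fun _ => 1, fun _ => Or.inl rfl, by simp⟩
  | insert i J hi ih =>
    obtain ⟨e, he, hle⟩ := ih
    set r := ∑ l ∈ J, (c i l + c l i) * e l with hr
    -- Under independent uniform signs the quadratic form has mean equal to the diagonal sum. The
    -- greedy choice made here derandomizes this: the sign of the new index makes the cross terms `v
    -- * r` nonnegative.
    obtain ⟨v, hv, hvr⟩ : ∃ v : ℝ, (v = 1 ∨ v = -1) ∧ 0 ≤ v * r := by
      rcases le_total 0 r with h | h
      · exact ⟨1, Or.inl rfl, by simpa using h⟩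
      · exact ⟨-1, Or.inr rfl, by linarith⟩
    refine ⟨Function.update e i v, fun j => ?_, ?_⟩
    · rcases eq_or_ne j i with rfl | hj
      · simpa using hv
      · simpa [hj] using he j
    · have hne : ∀ j ∈ J, j ≠ i := fun j hj h => hi (h ▸ hj)
      have hup : ∀ j ∈ J, Function.update e i v j = e j := fun j hj => by
        simp [Function.update_of_ne (hne j hj)]
      have e1 : ∑ j ∈ J, ∑ l ∈ J, c j l * (Function.update e i v j * Function.update e i v l) =
          ∑ j ∈ J, ∑ l ∈ J, c j l * (e j * e l) :=
        Finset.sum_congr rfl fun j hj => Finset.sum_congr rfl fun l hl => by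
          rw [hup j hj, hup l hl]
      have e2 : ∑ l ∈ J, c i l * (v * Function.update e i v l) +
          ∑ j ∈ J, c j i * (Function.update e i v j * v) = v * r := by
        rw [hr, ← Finset.sum_add_distrib, Finset.mul_sum]
        refine Finset.sum_congr rfl fun l hl => ?_
        rw [hup l hl]; ring
      have hv2 : v * v = 1 := by rcases hv with rfl | rfl <;> norm_num
      simp only [Finset.sum_insert hi, Finset.sum_add_distrib, Function.update_self]
      rw [e1, hv2]
      linarith

section

variable {Ω : Type*} {𝒜 ℬ : MeasurableSpace Ω} [mΩ : MeasurableSpace Ω] {P : Measure Ω}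

lemma dep_comm (A B : Set Ω) : dep P A B = dep P B A := by
  rw [dep, dep, Set.inter_comm, mul_comm]

variable [IsProbabilityMeasure P]

lemma abs_dep_le_one (A B : Set Ω) : |dep P A B| ≤ 1 := by
  have h1 : P.real (A ∩ B) ≤ 1 := measureReal_le_one
  have h2 : P.real A ≤ 1 := measureReal_le_one
  have h3 : P.real B ≤ 1 := measureReal_le_one
  have h4 := mul_le_one₀ h2 measureReal_nonneg h3
  have h5 : 0 ≤ P.real (A ∩ B) := measureReal_nonneg
  have h6 : 0 ≤ P.real A * P.real B := mul_nonneg measureReal_nonneg measureReal_nonneg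
  rw [dep, abs_le]; constructor <;> linarith

lemma dep_biUnion_left {ι : Type*} (J : Finset ι) {A : ι → Set Ω} (hA : ∀ j, MeasurableSet (A j))
    (hd : Pairwise (Function.onFun Disjoint A)) {B : Set Ω} (hB : MeasurableSet B) :
    dep P (⋃ j ∈ J, A j) B = ∑ j ∈ J, dep P (A j) B := by
  simp only [dep]
  rw [Set.iUnion₂_inter, measureReal_biUnion_finset, measureReal_biUnion_finset,
    Finset.sum_sub_distrib, Finset.sum_mul]
  · exact fun i _ j _ hij => hd hij
  · exact fun i _ => hA i
  · exact fun i _ j _ hij => (hd hij).mono Set.inter_subset_left Set.inter_subset_left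
  · exact fun i _ => (hA i).inter hB

lemma dep_biUnion_right {ι : Type*} (J : Finset ι) {A : Set Ω} (hA : MeasurableSet A)
    {B : ι → Set Ω} (hB : ∀ j, MeasurableSet (B j)) (hd : Pairwise (Function.onFun Disjoint B)) :
    dep P A (⋃ j ∈ J, B j) = ∑ j ∈ J, dep P A (B j) := by
  rw [dep_comm, dep_biUnion_left J hB hd hA]
  exact Finset.sum_congr rfl fun j _ => dep_comm _ _

lemma sum_mul_sign {ι : Type*} (J : Finset ι) {e : ι → ℝ} (he : ∀ j, e j = 1 ∨ e j = -1)
    (g : ι → ℝ) : ∑ j ∈ J, g j * e j =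
      ∑ j ∈ J with e j = 1, g j - ∑ j ∈ J with ¬ e j = 1, g j := by
  rw [← Finset.sum_filter_add_sum_filter_not J (fun j => e j = 1) (fun j => g j * e j), sub_eq_add_neg,
    ← Finset.sum_neg_distrib]
  congr 1
  · exact Finset.sum_congr rfl fun j hj => by rw [(Finset.mem_filter.1 hj).2, mul_one]
  · exact Finset.sum_congr rfl fun j hj => by
      rw [(he j).resolve_left (Finset.mem_filter.1 hj).2]; ring

/-- If `|P (A ∩ B) - P A P B| ≤ κ` for all `A ∈ 𝒜` and `B ∈ ℬ`, then these deviations sum up to at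
most `4 κ` along disjoint `A j` and disjoint `B j`. -/
lemma sum_abs_dep_le (h𝒜 : 𝒜 ≤ mΩ) (hℬ : ℬ ≤ mΩ) {κ : ℝ}
    (hκ : ∀ A B, MeasurableSet[𝒜] A → MeasurableSet[ℬ] B → |dep P A B| ≤ κ)
    {ι : Type*} (J : Finset ι) {A B : ι → Set Ω}
    (hA : ∀ j, MeasurableSet[𝒜] (A j)) (hB : ∀ j, MeasurableSet[ℬ] (B j))
    (hdA : Pairwise (Function.onFun Disjoint A)) (hdB : Pairwise (Function.onFun Disjoint B)) :
    ∑ j ∈ J, |dep P (A j) (B j)| ≤ 4 * κ := by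
  obtain ⟨s, hs, hsabs⟩ : ∃ s : ι → ℝ, (∀ j, s j = 1 ∨ s j = -1) ∧
      ∀ j, |dep P (A j) (B j)| = dep P (A j) (B j) * s j := by
    refine ⟨fun j => if 0 ≤ dep P (A j) (B j) then 1 else -1, fun j => ?_, fun j => ?_⟩
    · dsimp only; split_ifs <;> simp
    · dsimp only; split_ifs with h
      · rw [abs_of_nonneg h, mul_one]
      · rw [abs_of_neg (not_le.1 h)]; ring
  -- The signs `s l` go into column `l`, so that the diagonal entries of the matrix are the absolute
  -- values to be summed.
  obtain ⟨e, he, hle⟩ := exists_signs_sum_diag_le J fun j l => dep P (A j) (B l) * s l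
  have hse : ∀ j, s j * e j = 1 ∨ s j * e j = -1 := fun j => by
    rcases hs j with h | h <;> rcases he j with h' | h' <;> simp [h, h']
  have key : ∀ J₁ J₂ : Finset ι, |∑ j ∈ J₁, ∑ l ∈ J₂, dep P (A j) (B l)| ≤ κ := by
    intro J₁ J₂
    have h1 : MeasurableSet[𝒜] (⋃ j ∈ J₁, A j) := Finset.measurableSet_biUnion J₁ fun j _ => hA j
    have h2 : MeasurableSet[ℬ] (⋃ j ∈ J₂, B j) := Finset.measurableSet_biUnion J₂ fun j _ => hB j
    have := hκ _ _ h1 h2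
    rw [dep_biUnion_left J₁ (fun j => h𝒜 _ (hA j)) hdA (hℬ _ h2)] at this
    simp_rw [dep_biUnion_right J₂ (h𝒜 _ (hA _)) (fun j => hℬ _ (hB j)) hdB] at this
    exact this
  have e1 : ∑ j ∈ J, ∑ l ∈ J, dep P (A j) (B l) * s l * (e j * e l) =
      ∑ j ∈ J, (∑ l ∈ J, dep P (A j) (B l) * (s l * e l)) * e j := by
    refine Finset.sum_congr rfl fun j _ => ?_
    rw [Finset.sum_mul]
    exact Finset.sum_congr rfl fun l _ => by ring
  simp_rw [hsabs]
  refine hle.trans ?_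
  rw [e1, sum_mul_sign J he]
  simp_rw [sum_mul_sign J hse, Finset.sum_sub_distrib]
  -- Splitting rows by `e j` and columns by `s l * e l` leaves four blocks with constant sign. Each
  -- is the deviation of one pair of unions, hence at most `κ` in absolute value.
  have a1 := abs_le.1 (key {j ∈ J | e j = 1} {l ∈ J | s l * e l = 1})
  have a2 := abs_le.1 (key {j ∈ J | e j = 1} {l ∈ J | ¬ s l * e l = 1})
  have a3 := abs_le.1 (key {j ∈ J | ¬ e j = 1} {l ∈ J | s l * e l = 1})
  have a4 := abs_le.1 (key {j ∈ J | ¬ e j = 1} {l ∈ J | ¬ s l * e l = 1})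
  linarith [a1.2, a2.1, a3.1, a4.2]

/-- A real supremum is informative only for a bounded family; the trivial bound `1` supplies this
for both nested suprema. -/
lemma abs_dep_le_alphaCoeff {A B : Set Ω} (hA : MeasurableSet[𝒜] A)
    (hB : MeasurableSet[ℬ] B) : |dep P A B| ≤ alphaCoeff P 𝒜 ℬ := by
  have hbd : ∀ A' : {A : Set Ω // MeasurableSet[𝒜] A},
      BddAbove (Set.range fun B : {B : Set Ω // MeasurableSet[ℬ] B} =>
        |P.real (A'.1 ∩ B.1) - P.real A'.1 * P.real B.1|) := fun A' =>
    ⟨1, by rintro _ ⟨B', rfl⟩; exact abs_dep_le_one A'.1 B'.1⟩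
  refine le_trans (le_ciSup (hbd ⟨A, hA⟩) ⟨B, hB⟩) (le_ciSup (f := fun A' :
    {A : Set Ω // MeasurableSet[𝒜] A} => ⨆ B : {B : Set Ω // MeasurableSet[ℬ] B},
      |P.real (A'.1 ∩ B.1) - P.real A'.1 * P.real B.1|) ⟨1, ?_⟩ ⟨A, hA⟩)
  rintro _ ⟨A', rfl⟩
  have : Nonempty {B : Set Ω // MeasurableSet[ℬ] B} := ⟨⟨B, hB⟩⟩
  exact ciSup_le fun B' => abs_dep_le_one A'.1 B'.1

variable (𝒜 ℬ) in
lemma alphaCoeff_le_one : alphaCoeff P 𝒜 ℬ ≤ 1 := by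
  have : Nonempty {A : Set Ω // MeasurableSet[𝒜] A} := ⟨⟨∅, @MeasurableSet.empty _ 𝒜⟩⟩
  have : Nonempty {B : Set Ω // MeasurableSet[ℬ] B} := ⟨⟨∅, @MeasurableSet.empty _ ℬ⟩⟩
  exact ciSup_le fun A' => ciSup_le fun B' => abs_dep_le_one A'.1 B'.1

lemma abs_dep_le_alphaTwo (X : ℝ → Ω → ℝ) (s t : ℝ) (hst : s ≤ t) {A B : Set Ω}
    (hA : MeasurableSet[MeasurableSpace.comap (X s) inferInstance] A)
    (hB : MeasurableSet[MeasurableSpace.comap (X t) inferInstance] B) :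
    |dep P A B| ≤ alphaTwo P X |t - s| := by
  rw [abs_of_nonneg (sub_nonneg.2 hst)]
  have hB' : MeasurableSet[MeasurableSpace.comap (X (s + (t - s))) inferInstance] B := by
    rwa [add_sub_cancel]
  refine (abs_dep_le_alphaCoeff hA hB').trans (le_ciSup (f := fun s' => alphaCoeff P
    (MeasurableSpace.comap (X s') inferInstance)
    (MeasurableSpace.comap (X (s' + (t - s))) inferInstance)) ⟨1, ?_⟩ s)
  rintro _ ⟨s', rfl⟩
  exact alphaCoeff_le_one _ _

/-- The mixing coefficient bounds the total dependence of `X s` and `X t` along disjoint sets. -/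
lemma sum_abs_dep_le_alphaTwo {X : ℝ → Ω → ℝ} (hX : ∀ t, Measurable (X t)) (s t : ℝ)
    {ι : Type*} (J : Finset ι) {A B : ι → Set ℝ}
    (hA : ∀ j, MeasurableSet (A j)) (hB : ∀ j, MeasurableSet (B j))
    (hdA : Pairwise (Function.onFun Disjoint A)) (hdB : Pairwise (Function.onFun Disjoint B)) :
    ∑ j ∈ J, |dep P (X s ⁻¹' A j) (X t ⁻¹' B j)| ≤ 4 * alphaTwo P X |t - s| := by
  -- `alphaTwo` compares an earlier time with a later one; the symmetry of `dep` reduces the other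
  -- order to this one.
  wlog hst : s ≤ t generalizing s t A B
  · have := this t s hB hA hdB hdA (le_of_not_ge hst)
    rw [abs_sub_comm]
    simpa only [dep_comm] using this
  exact sum_abs_dep_le (hX s).comap_le (hX t).comap_le
    (fun A B hA hB => abs_dep_le_alphaTwo X s t hst hA hB) J
    (fun j => ⟨A j, hA j, rfl⟩) (fun j => ⟨B j, hB j, rfl⟩)
    (fun i j hij => (hdA hij).preimage _) (fun i j hij => (hdB hij).preimage _)

end

/-! ### Covariances of the kernel at two fixed times -/

section

variable {Ω : Type*} [MeasurableSpace Ω] {P : Measure Ω}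
  {X : ℝ → Ω → ℝ} {f : ℝ → ℝ} {f₂ : ℝ → ℝ × ℝ → ℝ}

lemma measureReal_preimage (hX : HasStationaryDensities P X f f₂) (t : ℝ) {A : Set ℝ}
    (hA : MeasurableSet A) : P.real (X t ⁻¹' A) = ∫ y in A, f y := by
  rw [integral_eq_lintegral_of_nonneg_ae (ae_of_all _ hX.nonneg_f)
    hX.measurable_f.aestronglyMeasurable, ← withDensity_apply _ hA, ← hX.map_eq t,
    Measure.map_apply (hX.measurable_X t) hA, measureReal_def]

lemma measureReal_preimage_inter (hX : HasStationaryDensities P X f f₂) {s t : ℝ} (hst : s ≠ t)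
    {A B : Set ℝ} (hA : MeasurableSet A) (hB : MeasurableSet B) :
    P.real (X s ⁻¹' A ∩ X t ⁻¹' B) = ∫ q in A ×ˢ B, f₂ |t - s| q := by
  have hpos : 0 < |t - s| := abs_pos.2 (sub_ne_zero.2 hst.symm)
  rw [integral_eq_lintegral_of_nonneg_ae (ae_of_all _ (hX.nonneg_f₂ _ hpos))
    (hX.measurable_f₂ _ hpos).aestronglyMeasurable, ← withDensity_apply _ (hA.prod hB),
    ← hX.map_pair_eq s t hst,
    Measure.map_apply ((hX.measurable_X s).prodMk (hX.measurable_X t)) (hA.prod hB),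
    measureReal_def]
  rfl

lemma measurable_polyKernel_comp {Y : Ω → ℝ} (hY : Measurable Y) (a h x : ℝ) :
    Measurable fun ω => polyKernel a h x (Y ω) :=
  (measurable_polyKernel a h).comp (measurable_const.prodMk hY)

variable [IsProbabilityMeasure P]

lemma integrable_density (hX : HasStationaryDensities P X f f₂) : Integrable f := by
  refine ⟨hX.measurable_f.aestronglyMeasurable, ?_⟩
  rw [hasFiniteIntegral_iff_ofReal (ae_of_all _ hX.nonneg_f)]
  have := congrArg (fun μ => μ Set.univ) (hX.map_eq 0)
  simp only [Measure.map_apply (hX.measurable_X 0) MeasurableSet.univ, Set.preimage_univ,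
    measure_univ, withDensity_apply _ MeasurableSet.univ, Measure.restrict_univ] at this
  rw [← this]; exact ENNReal.one_lt_top

lemma integrable_pairDensity (hX : HasStationaryDensities P X f f₂) {s t : ℝ} (hst : s ≠ t) :
    Integrable (f₂ |t - s|) := by
  have hpos : 0 < |t - s| := abs_pos.2 (sub_ne_zero.2 hst.symm)
  refine ⟨(hX.measurable_f₂ _ hpos).aestronglyMeasurable, ?_⟩
  rw [hasFiniteIntegral_iff_ofReal (ae_of_all _ (hX.nonneg_f₂ _ hpos))]
  have := congrArg (fun μ => μ Set.univ) (hX.map_pair_eq s t hst)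
  simp only [Measure.map_apply ((hX.measurable_X s).prodMk (hX.measurable_X t)) MeasurableSet.univ,
    Set.preimage_univ, measure_univ, withDensity_apply _ MeasurableSet.univ,
    Measure.restrict_univ] at this
  rw [← this]; exact ENNReal.one_lt_top

/-- A bound of `g_u (y, z)` by `k y` bounds the dependence of `X s` and `X t` on rectangles. -/
lemma ofReal_abs_dep_le_density (hX : HasStationaryDensities P X f f₂) {s t : ℝ} (hst : s ≠ t)
    {k : ℝ → ℝ} (hkm : Measurable k) (hk : ∀ y z, |pairDiff f f₂ |t - s| y z| ≤ k y)
    {A B : Set ℝ} (hA : MeasurableSet A) (hB : MeasurableSet B) :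
    ENNReal.ofReal |dep P (X s ⁻¹' A) (X t ⁻¹' B)| ≤
      volume B * ∫⁻ y in A, ENNReal.ofReal (k y) := by
  have hdep : dep P (X s ⁻¹' A) (X t ⁻¹' B) =
      ∫ q in A ×ˢ B, pairDiff f f₂ |t - s| q.1 q.2 := by
    have hfi := integrable_density hX
    simp only [pairDiff, Prod.mk.eta]
    rw [integral_sub (integrable_pairDensity hX hst).integrableOn, dep,
      measureReal_preimage_inter hX hst hA hB, measureReal_preimage hX s hA,
      measureReal_preimage hX t hB, Measure.volume_eq_prod, ← Measure.prod_restrict,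
      integral_prod_mul]
    rw [Measure.volume_eq_prod]
    exact (hfi.mul_prod hfi).integrableOn
  rw [hdep, ← Real.norm_eq_abs, ofReal_norm]
  refine (enorm_integral_le_lintegral_enorm _).trans ?_
  calc ∫⁻ q in A ×ˢ B, ‖pairDiff f f₂ |t - s| q.1 q.2‖ₑ
      ≤ ∫⁻ q in A ×ˢ B, ENNReal.ofReal (k q.1) := by
        refine lintegral_mono fun q => ?_
        rw [← ofReal_norm]
        exact ENNReal.ofReal_le_ofReal (hk _ _)
    _ = volume B * ∫⁻ y in A, ENNReal.ofReal (k y) := by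
        rw [Measure.volume_eq_prod, ← Measure.prod_restrict, lintegral_prod _
          (by fun_prop)]
        simp only [lintegral_const, Measure.restrict_apply_univ]
        rw [lintegral_mul_const _ (by fun_prop), mul_comm]

/-- The covariance of the kernel at `x` for the observations at the times `s` and `t`. -/
noncomputable def kernelCov (P : Measure Ω) (X : ℝ → Ω → ℝ) (a h x s t : ℝ) : ℝ :=
  cov[fun ω => polyKernel a h x (X s ω), fun ω => polyKernel a h x (X t ω); P]

lemma memLp_of_bounded {Y : Ω → ℝ} (hY : Measurable Y) (h0 : ∀ ω, 0 ≤ Y ω) (h1 : ∀ ω, Y ω ≤ 1) :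
    MemLp Y 2 P :=
  MemLp.of_bound hY.aestronglyMeasurable 1 (ae_of_all _ fun ω => by
    rw [Real.norm_eq_abs, abs_of_nonneg (h0 ω)]; exact h1 ω)

lemma memLp_polyKernel {Y : Ω → ℝ} (hY : Measurable Y) {a h : ℝ} (hh : 0 < h) (x : ℝ) :
    MemLp (fun ω => polyKernel a h x (Y ω)) 2 P :=
  memLp_of_bounded (measurable_polyKernel_comp hY a h x) (fun _ => polyKernel_nonneg _ _ _ _)
    (fun _ => polyKernel_le_one hh _ _)

/-- The product of the means is nonnegative and can be dropped, and `2 K K' ≤ K ^ 2 + K' ^ 2`. By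
Tonelli each square integrates to `2 h / 3` for every outcome. The case `s = t` is allowed and
covers the diagonal. -/
lemma lintegral_kernelCov_le (hX : ∀ t, Measurable (X t)) {a h : ℝ} (hh : 0 < h) (s t : ℝ) :
    ∫⁻ x, ENNReal.ofReal (kernelCov P X a h x s t) ≤ ENNReal.ofReal (2 / 3 * h) := by
  have hm : ∀ t, Measurable fun q : ℝ × Ω =>
      2⁻¹ * ENNReal.ofReal (polyKernel a h q.1 (X t q.2) ^ 2) := fun t =>
    (((measurable_polyKernel a h).comp
      (measurable_fst.prodMk ((hX t).comp measurable_snd))).pow_const 2).ennreal_ofReal.const_mul _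
  have hpt : ∀ x, ENNReal.ofReal (kernelCov P X a h x s t) ≤
      ∫⁻ ω, (2⁻¹ * ENNReal.ofReal (polyKernel a h x (X s ω) ^ 2) +
        2⁻¹ * ENNReal.ofReal (polyKernel a h x (X t ω) ^ 2)) ∂P := by
    intro x
    have hs := memLp_polyKernel (P := P) (hX s) hh (a := a) x
    have ht := memLp_polyKernel (P := P) (hX t) hh (a := a) x
    rw [kernelCov, covariance_eq_sub hs ht]
    refine (ENNReal.ofReal_le_ofReal (sub_le_self _ (mul_nonneg
      (integral_nonneg fun _ => polyKernel_nonneg _ _ _ _)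
      (integral_nonneg fun _ => polyKernel_nonneg _ _ _ _)))).trans ?_
    rw [ofReal_integral_eq_lintegral_ofReal (hs.integrable_mul ht) (ae_of_all _ fun ω =>
      mul_nonneg (polyKernel_nonneg _ _ _ _) (polyKernel_nonneg _ _ _ _))]
    refine lintegral_mono fun ω => ?_
    have h2 : (2⁻¹ : ℝ≥0∞) = ENNReal.ofReal 2⁻¹ := by
      rw [ENNReal.ofReal_inv_of_pos two_pos]; simp
    rw [h2, ← ENNReal.ofReal_mul (by norm_num), ← ENNReal.ofReal_mul (by norm_num),
      ← ENNReal.ofReal_add (by positivity) (by positivity)]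
    refine ENNReal.ofReal_le_ofReal ?_
    simp only [Pi.mul_apply]
    nlinarith [sq_nonneg (polyKernel a h x (X s ω) - polyKernel a h x (X t ω))]
  refine (lintegral_mono hpt).trans ?_
  rw [lintegral_lintegral_swap ((hm s).add (hm t)).aemeasurable]
  have hm' : ∀ t ω, Measurable fun x => ENNReal.ofReal (polyKernel a h x (X t ω) ^ 2) :=
    fun t ω => (((measurable_polyKernel a h).comp
      (measurable_id.prodMk measurable_const)).pow_const 2).ennreal_ofReal
  have : ∀ ω, ∫⁻ x, (2⁻¹ * ENNReal.ofReal (polyKernel a h x (X s ω) ^ 2) +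
        2⁻¹ * ENNReal.ofReal (polyKernel a h x (X t ω) ^ 2)) = ENNReal.ofReal (2 / 3 * h) := by
    intro ω
    rw [lintegral_add_left ((hm' s ω).const_mul _), lintegral_const_mul _ (hm' s ω),
      lintegral_const_mul _ (hm' t ω), lintegral_polyKernel_sq hh, lintegral_polyKernel_sq hh,
      ← add_mul, ENNReal.inv_two_add_inv_two, one_mul]
  simp_rw [this]
  simp

lemma cov_indicator {A B : Set Ω} (hA : MeasurableSet A) (hB : MeasurableSet B) :
    cov[A.indicator (fun _ => (1 : ℝ)), B.indicator (fun _ => (1 : ℝ)); P] = dep P A B := by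
  have hm : ∀ {A : Set Ω}, MeasurableSet A → MemLp (A.indicator (fun _ => (1 : ℝ))) 2 P :=
    fun hA => (memLp_const 1).indicator hA
  have hmul : (A.indicator (fun _ => (1 : ℝ)) * B.indicator (fun _ => (1 : ℝ))) =
      (A ∩ B).indicator (fun _ => (1 : ℝ)) := by
    funext ω
    by_cases h1 : ω ∈ A <;> by_cases h2 : ω ∈ B <;> simp [h1, h2]
  rw [covariance_eq_sub (hm hA) (hm hB), hmul, integral_indicator_const _ hA,
    integral_indicator_const _ hB, integral_indicator_const _ (hA.inter hB), dep]
  simp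

/-- On a cell the kernel combines two bin indicators with weights in `[0, 1]`, so the covariance
expands bilinearly into four terms. The form `j + 0` makes them instances of one family indexed by
the pair of shifts. -/
lemma kernelCov_le_of_mem_cell (hX : ∀ t, Measurable (X t)) {a h : ℝ} (hh : 0 < h) (s t : ℝ)
    {j : ℤ} {x : ℝ} (hx : x ∈ cell a h j) :
    kernelCov P X a h x s t ≤
      |dep P (X s ⁻¹' bin a h (j + 0)) (X t ⁻¹' bin a h (j + 0))| +
      |dep P (X s ⁻¹' bin a h (j + 0)) (X t ⁻¹' bin a h (j + 1))| +
      (|dep P (X s ⁻¹' bin a h (j + 1)) (X t ⁻¹' bin a h (j + 0))| +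
      |dep P (X s ⁻¹' bin a h (j + 1)) (X t ⁻¹' bin a h (j + 1))|) := by
  have hw : ∃ w v : ℝ, 0 ≤ w ∧ 0 ≤ v ∧ w ≤ 1 ∧ v ≤ 1 ∧ ∀ y, polyKernel a h x y =
      w * (bin a h j).indicator (fun _ => 1) y + v * (bin a h (j + 1)).indicator (fun _ => 1) y := by
    refine ⟨(binMid a h (j + 1) - x) / h, (x - binMid a h j) / h, ?_, ?_, ?_, ?_,
      polyKernel_of_mem_cell hh hx⟩
    · exact div_nonneg (sub_nonneg.2 hx.2.le) hh.le
    · exact div_nonneg (sub_nonneg.2 hx.1) hh.le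
    · have := hx.1
      rw [div_le_one hh, binMid_eq] at *; push_cast; linarith
    · have := hx.2
      rw [div_le_one hh, binMid_eq] at *; push_cast at this; linarith
  obtain ⟨w, v, hw0, hv0, hw1, hv1, hwv⟩ := hw
  simp only [add_zero]
  set A₀ := X s ⁻¹' bin a h j with hA₀
  set A₁ := X s ⁻¹' bin a h (j + 1) with hA₁
  set B₀ := X t ⁻¹' bin a h j with hB₀
  set B₁ := X t ⁻¹' bin a h (j + 1) with hB₁
  have mA₀ : MeasurableSet A₀ := hX s (measurableSet_bin a h j)
  have mA₁ : MeasurableSet A₁ := hX s (measurableSet_bin a h (j + 1))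
  have mB₀ : MeasurableSet B₀ := hX t (measurableSet_bin a h j)
  have mB₁ : MeasurableSet B₁ := hX t (measurableSet_bin a h (j + 1))
  have hm : ∀ {A : Set Ω}, MeasurableSet A → MemLp (A.indicator (fun _ => (1 : ℝ))) 2 P :=
    fun hA => (memLp_const 1).indicator hA
  have e1 : (fun ω => polyKernel a h x (X s ω)) =
      w • A₀.indicator (fun _ => (1 : ℝ)) + v • A₁.indicator (fun _ => (1 : ℝ)) := by
    funext ω; rw [hwv]; rfl
  have e2 : (fun ω => polyKernel a h x (X t ω)) =
      w • B₀.indicator (fun _ => (1 : ℝ)) + v • B₁.indicator (fun _ => (1 : ℝ)) := by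
    funext ω; rw [hwv]; rfl
  have bd : ∀ {a b d : ℝ}, 0 ≤ a → 0 ≤ b → a ≤ 1 → b ≤ 1 → a * (b * d) ≤ |d| := by
    intro a b d ha hb ha1 hb1
    calc a * (b * d) ≤ |a * (b * d)| := le_abs_self _
      _ = a * b * |d| := by rw [abs_mul, abs_mul, abs_of_nonneg ha, abs_of_nonneg hb]; ring
      _ ≤ 1 * |d| := mul_le_mul_of_nonneg_right (mul_le_one₀ ha1 hb hb1) (abs_nonneg _)
      _ = |d| := one_mul _
  rw [kernelCov, e1, e2, covariance_add_left ((hm mA₀).const_smul w) ((hm mA₁).const_smul v)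
    (((hm mB₀).const_smul w).add ((hm mB₁).const_smul v)),
    covariance_add_right ((hm mA₀).const_smul w) ((hm mB₀).const_smul w) ((hm mB₁).const_smul v),
    covariance_add_right ((hm mA₁).const_smul v) ((hm mB₀).const_smul w) ((hm mB₁).const_smul v)]
  simp only [covariance_smul_left, covariance_smul_right, cov_indicator mA₀ mB₀,
    cov_indicator mA₀ mB₁, cov_indicator mA₁ mB₀, cov_indicator mA₁ mB₁]
  gcongr <;> apply bd <;> assumption

/-- The integral over `x` of the positive part of the kernel covariance is at most `4 h κ` when `κ`
bounds the total dependence of `X s` and `X t` along the bins. -/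
lemma lintegral_kernelCov_le_of_sum_dep_le (hX : ∀ t, Measurable (X t)) {a h : ℝ} (hh : 0 < h)
    (s t : ℝ) {κ : ℝ≥0∞} (hκ : ∀ i l : ℤ, ∑' j : ℤ, ENNReal.ofReal
      |dep P (X s ⁻¹' bin a h (j + i)) (X t ⁻¹' bin a h (j + l))| ≤ κ) :
    ∫⁻ x, ENNReal.ofReal (kernelCov P X a h x s t) ≤ ENNReal.ofReal h * (4 * κ) := by
  set d : ℤ → ℤ → ℤ → ℝ≥0∞ := fun i l j => ENNReal.ofReal
      |dep P (X s ⁻¹' bin a h (j + i)) (X t ⁻¹' bin a h (j + l))| with hd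
  rw [lintegral_eq_tsum_cell hh (a := a)]
  calc ∑' j, ∫⁻ x in cell a h j, ENNReal.ofReal (kernelCov P X a h x s t)
      ≤ ∑' j, ENNReal.ofReal h * (d 0 0 j + d 0 1 j + (d 1 0 j + d 1 1 j)) := by
        refine ENNReal.tsum_le_tsum fun j => ?_
        calc ∫⁻ x in cell a h j, ENNReal.ofReal (kernelCov P X a h x s t)
            ≤ ∫⁻ x in cell a h j, (d 0 0 j + d 0 1 j + (d 1 0 j + d 1 1 j)) := by
              refine setLIntegral_mono measurable_const fun x hx => ?_
              refine (ENNReal.ofReal_le_ofReal (kernelCov_le_of_mem_cell hX hh s t hx)).trans ?_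
              rw [ENNReal.ofReal_add (by positivity) (by positivity),
                ENNReal.ofReal_add (by positivity) (by positivity),
                ENNReal.ofReal_add (by positivity) (by positivity)]
          _ = _ := by rw [setLIntegral_const, volume_cell, mul_comm]
    _ = ENNReal.ofReal h * (∑' j, d 0 0 j + ∑' j, d 0 1 j + (∑' j, d 1 0 j + ∑' j, d 1 1 j)) := by
        rw [ENNReal.tsum_mul_left, ENNReal.tsum_add, ENNReal.tsum_add, ENNReal.tsum_add]
    _ ≤ ENNReal.ofReal h * (κ + κ + (κ + κ)) := by gcongr <;> apply hκ
    _ = _ := by ring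

lemma pairwise_disjoint_bin_add {a h : ℝ} (hh : 0 < h) (i : ℤ) :
    Pairwise (Function.onFun Disjoint fun j => bin a h (j + i)) :=
  fun _ _ hjl => pairwise_disjoint_bin hh fun he => hjl (add_right_cancel he)

/-- The only factor `h` is the length of a cell: the sum over all the bins is absorbed by the mixing
coefficient, uniformly over finite sets of bins. -/
lemma lintegral_kernelCov_le_alphaTwo (hX : ∀ t, Measurable (X t)) {a h : ℝ} (hh : 0 < h)
    (s t : ℝ) : ∫⁻ x, ENNReal.ofReal (kernelCov P X a h x s t) ≤
      ENNReal.ofReal h * (4 * ENNReal.ofReal (4 * alphaTwo P X |t - s|)) := by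
  refine lintegral_kernelCov_le_of_sum_dep_le hX hh s t fun i l => ?_
  rw [ENNReal.tsum_eq_iSup_sum]
  refine iSup_le fun J => ?_
  rw [← ENNReal.ofReal_sum_of_nonneg fun _ _ => abs_nonneg _]
  exact ENNReal.ofReal_le_ofReal (sum_abs_dep_le_alphaTwo hX s t J
    (fun j => measurableSet_bin a h (j + i)) (fun j => measurableSet_bin a h (j + l))
    (pairwise_disjoint_bin_add hh i) (pairwise_disjoint_bin_add hh l))

/-- The second coordinate contributes the width of a bin, and the disjoint bins of the first
coordinate reassemble `∫ k`. This gains a factor `h` over the mixing bound, without decay in the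
lag. -/
lemma lintegral_kernelCov_le_density (hX : HasStationaryDensities P X f f₂) {s t : ℝ} (hst : s ≠ t)
    {k : ℝ → ℝ} (hkm : Measurable k) (hk : ∀ y z, |pairDiff f f₂ |t - s| y z| ≤ k y)
    {a h : ℝ} (hh : 0 < h) : ∫⁻ x, ENNReal.ofReal (kernelCov P X a h x s t) ≤
      ENNReal.ofReal h * (4 * (ENNReal.ofReal h * ∫⁻ y, ENNReal.ofReal (k y))) := by
  refine lintegral_kernelCov_le_of_sum_dep_le hX.measurable_X hh s t fun i l => ?_
  refine (ENNReal.tsum_le_tsum fun j => ofReal_abs_dep_le_density hX hst hkm hk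
    (measurableSet_bin a h (j + i)) (measurableSet_bin a h (j + l))).trans ?_
  simp_rw [volume_bin]
  rw [ENNReal.tsum_mul_left, ← lintegral_iUnion (fun j => measurableSet_bin a h (j + i))
    (pairwise_disjoint_bin_add hh i)]
  gcongr
  exact Measure.restrict_le_self

end

/-! ### The lags of the sampling times -/

section

variable {Ω : Type*} [MeasurableSpace Ω] {P : Measure Ω}

/-- The law of the lag between the time `0` and the time `m`. -/
noncomputable def lagLaw (P : Measure Ω) (t : ℕ → Ω → ℝ) (m : ℕ) : Measure ℝ :=
  P.map fun ω => |t m ω - t 0 ω|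

/-- Twice the intensity measure of the lags from the time `0` to the later times. -/
noncomputable def lagMeasure (P : Measure Ω) (t : ℕ → Ω → ℝ) : Measure ℝ :=
  (2 : ℝ≥0∞) • Measure.sum fun m => lagLaw P t (m + 1)

/-- The law of the lag between the times `k` and `l` depends on `l - k` only. -/
def StationaryLags (P : Measure Ω) (t : ℕ → Ω → ℝ) : Prop :=
  ∀ k m, P.map (fun ω => |t (k + (m + 1)) ω - t k ω|) = lagLaw P t (m + 1)

lemma measurable_lag {t : ℕ → Ω → ℝ} (ht : ∀ k, Measurable (t k)) (k l : ℕ) :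
    Measurable fun ω => |t l ω - t k ω| := by
  have := ht k
  have := ht l
  fun_prop

lemma measurable_finsetSum {τ : ℕ → Ω → ℝ} (hτ : ∀ k, Measurable (τ k)) (s : Finset ℕ) :
    Measurable (∑ i ∈ s, τ i) := by
  rw [Finset.sum_fn]
  exact Finset.measurable_fun_sum _ fun i _ => hτ i

lemma sum_le_tsum_of_injOn {ι : Type*} (s : Finset ι) (φ : ι → ℕ) (hφ : Set.InjOn φ s)
    (L : ℕ → ℝ≥0∞) : ∑ i ∈ s, L (φ i) ≤ ∑' m, L m := by
  classical
  rw [← Finset.sum_image hφ]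
  exact ENNReal.sum_le_tsum _

/-- For fixed `k`, the indices after `k` and those before `k` each give part of the series of lag
expectations, whence the factor `2` in `lagMeasure`. The shift `l - k - 1` appears because lag
number `m` spans `m + 1` sampling steps. -/
lemma sum_lintegral_lag_le {t : ℕ → Ω → ℝ} (ht : ∀ k, Measurable (t k))
    (hst : StationaryLags P t) {ψ : ℝ → ℝ≥0∞} (hψ : Measurable ψ) (n : ℕ) :
    ∑ k ∈ Finset.Icc 1 n, ∑ l ∈ (Finset.Icc 1 n).erase k, ∫⁻ ω, ψ |t l ω - t k ω| ∂P ≤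
      n * ∫⁻ u, ψ u ∂(lagMeasure P t) := by
  set L : ℕ → ℝ≥0∞ := fun m => ∫⁻ u, ψ u ∂(lagLaw P t (m + 1)) with hL
  have hlag : ∀ k m, ∫⁻ ω, ψ |t (k + (m + 1)) ω - t k ω| ∂P = L m := by
    intro k m
    simp only [hL]
    rw [← hst k m, lintegral_map hψ (measurable_lag ht k _)]
  have hsum : ∫⁻ u, ψ u ∂(lagMeasure P t) = ∑' m, L m + ∑' m, L m := by
    rw [lagMeasure, lintegral_smul_measure, lintegral_sum_measure, smul_eq_mul, two_mul]
  have hk : ∀ k ∈ Finset.Icc 1 n, ∑ l ∈ (Finset.Icc 1 n).erase k, ∫⁻ ω, ψ |t l ω - t k ω| ∂P ≤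
      ∫⁻ u, ψ u ∂(lagMeasure P t) := by
    intro k _
    rw [hsum, ← Finset.sum_filter_add_sum_filter_not _ (fun l => k < l)]
    refine add_le_add ?_ ?_
    · refine le_trans (le_of_eq (Finset.sum_congr rfl fun l hl => ?_))
        (sum_le_tsum_of_injOn _ (fun l => l - k - 1) ?_ L)
      · have hkl := (Finset.mem_filter.1 hl).2
        rw [← hlag k, show k + (l - k - 1 + 1) = l by omega]
      · intro l hl l' hl' h
        simp only [Finset.coe_filter, Set.mem_ofPred_eq] at hl hl' h
        omega
    · refine le_trans (le_of_eq (Finset.sum_congr rfl fun l hl => ?_))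
        (sum_le_tsum_of_injOn _ (fun l => k - l - 1) ?_ L)
      · have hkl := (Finset.mem_filter.1 hl).2
        have hne := Finset.ne_of_mem_erase (Finset.mem_filter.1 hl).1
        rw [← hlag l, show l + (k - l - 1 + 1) = k by omega]
        simp_rw [abs_sub_comm]
      · intro l hl l' hl' h
        simp only [Finset.coe_filter, Set.mem_ofPred_eq, Finset.mem_erase] at hl hl' h
        omega
  refine (Finset.sum_le_sum hk).trans ?_
  simp

/-! ### Renewal sampling -/

lemma measurable_convPow {g : ℝ → ℝ} (hg : Measurable g) (m : ℕ) : Measurable (convPow g m) := by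
  induction m with
  | zero => exact hg.ennreal_ofReal
  | succ m ih => exact measurable_lconvolution _ ih hg.ennreal_ofReal

/-- This restricts the lag set `|s| < M` to `0 ≤ s < M`; otherwise the design constant would be
doubled. -/
lemma convPow_of_neg {g : ℝ → ℝ} (hg : ∀ s, s < 0 → g s = 0) (m : ℕ) {s : ℝ} (hs : s < 0) :
    convPow g m s = 0 := by
  induction m generalizing s with
  | zero => simp [convPow, hg s hs]
  | succ m ih =>
    rw [convPow, lconvolution_def]
    refine (lintegral_congr fun y => ?_).trans lintegral_zero
    rcases lt_or_ge y 0 with hy | hy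
    · rw [ih hy, zero_mul]
    · rw [hg _ (by linarith), ENNReal.ofReal_zero, mul_zero]

lemma IsRenewalSampling.measurable {t : ℕ → Ω → ℝ} {g : ℝ → ℝ}
    (h : IsRenewalSampling P t g) (k : ℕ) : Measurable (t k) := by
  obtain ⟨τ, hτ, -, -, ht⟩ := h.exists_increments
  rw [funext (ht k)]
  exact Finset.measurable_fun_sum _ fun i _ => hτ i

lemma IsJitteredSampling.measurable {t : ℕ → Ω → ℝ} {δ : ℝ} {gJ : ℝ → ℝ}
    (h : IsJitteredSampling P t δ gJ) (k : ℕ) : Measurable (t k) := by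
  obtain ⟨Z, hZ, -, -, ht⟩ := h.exists_noise
  rw [funext (ht k)]
  exact (hZ k).const_add _

/-- Each of the two noises moves its time by at most `δ / 2`, so a lag of `m + 1` periods loses at
most one period. -/
lemma IsJitteredSampling.lagLaw_Iio {t : ℕ → Ω → ℝ} {δ : ℝ} {gJ : ℝ → ℝ}
    (h : IsJitteredSampling P t δ gJ) {m : ℕ} {M : ℝ} (hM : M ≤ m * δ) :
    lagLaw P t (m + 1) (Set.Iio M) = 0 := by
  obtain ⟨Z, hZ, -, hlaw, ht⟩ := h.exists_noise
  have hbd : ∀ k, ∀ᵐ ω ∂P, |Z k ω| ≤ δ / 2 := by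
    intro k
    have hS : MeasurableSet {z : ℝ | |z| ≤ δ / 2} := measurableSet_le measurable_abs measurable_const
    have : ∀ᵐ z ∂(P.map (Z k)), |z| ≤ δ / 2 := by
      rw [hlaw k, ae_withDensity_iff h.measurable_gJ.ennreal_ofReal]
      refine ae_of_all _ fun z hz => ?_
      by_contra! hz'
      exact hz (by rw [h.support_gJ z hz', ENNReal.ofReal_zero])
    exact (ae_map_iff (hZ k).aemeasurable hS).1 this
  rw [lagLaw, Measure.map_apply (measurable_lag h.measurable 0 _) measurableSet_Iio]
  have : ∀ᵐ ω ∂P, ω ∉ (fun ω => |t (m + 1) ω - t 0 ω|) ⁻¹' Set.Iio M := by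
    filter_upwards [hbd (m + 1), hbd 0] with ω h1 h2
    simp only [Set.mem_preimage, Set.mem_Iio, not_lt, ht]
    refine hM.trans (le_trans ?_ (le_abs_self _))
    push_cast
    linarith [(abs_le.1 h1).1, (abs_le.1 h2).2]
  exact measure_eq_zero_iff_ae_notMem.2 this

variable [IsProbabilityMeasure P]

lemma map_sum_Ico_eq_withDensity {τ : ℕ → Ω → ℝ} {g : ℝ → ℝ} (hg : Measurable g)
    (hτ : ∀ k, Measurable (τ k)) (hind : iIndepFun τ P)
    (hlaw : ∀ k, P.map (τ k) = volume.withDensity (fun s => ENNReal.ofReal (g s))) (k m : ℕ) :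
    P.map (∑ i ∈ Finset.Ico k (k + (m + 1)), τ i) = volume.withDensity (convPow g m) := by
  induction m with
  | zero =>
    have : Finset.Ico k (k + (0 + 1)) = {k} := by ext i; simp
    rw [this, Finset.sum_singleton, hlaw]; rfl
  | succ m ih =>
    have hins : Finset.Ico k (k + (m + 1 + 1)) =
        insert (k + (m + 1)) (Finset.Ico k (k + (m + 1))) := by ext i; simp; omega
    have hnot : k + (m + 1) ∉ Finset.Ico k (k + (m + 1)) := by simp
    rw [hins, Finset.sum_insert hnot, add_comm (τ _),
      (hind.indepFun_finsetSum_of_notMem hτ hnot).map_add_eq_map_conv_map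
        (measurable_finsetSum hτ _) (hτ _), ih, hlaw,
      conv_withDensity_eq_lconvolution (measurable_convPow hg m) hg.ennreal_ofReal]
    rfl

lemma IsRenewalSampling.map_lag {t : ℕ → Ω → ℝ} {g : ℝ → ℝ} (h : IsRenewalSampling P t g)
    (k m : ℕ) : P.map (fun ω => |t (k + (m + 1)) ω - t k ω|) =
      (volume.withDensity (convPow g m)).map (fun s => |s|) := by
  obtain ⟨τ, hτ, hind, hlaw, ht⟩ := h.exists_increments
  rw [← map_sum_Ico_eq_withDensity h.measurable_g hτ hind hlaw k m,
    Measure.map_map measurable_abs (measurable_finsetSum hτ _)]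
  congr 1
  funext ω
  simp only [Function.comp_apply, Finset.sum_apply, ht]
  rw [Finset.sum_Ico_eq_sub _ (by omega)]

lemma IsRenewalSampling.stationaryLags {t : ℕ → Ω → ℝ} {g : ℝ → ℝ}
    (h : IsRenewalSampling P t g) : StationaryLags P t := by
  intro k m
  have := h.map_lag 0 m
  rw [zero_add] at this
  rw [h.map_lag k m, lagLaw, this]

lemma IsRenewalSampling.lagMeasure_apply {t : ℕ → Ω → ℝ} {g : ℝ → ℝ}
    (h : IsRenewalSampling P t g) {A : Set ℝ} (hA : MeasurableSet A) :
    lagMeasure P t A = 2 * ∫⁻ s in (fun s => |s|) ⁻¹' A, renewalDensity g s := by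
  have hA' : MeasurableSet ((fun s : ℝ => |s|) ⁻¹' A) := measurable_abs hA
  rw [lagMeasure, Measure.smul_apply, smul_eq_mul, Measure.sum_apply _ hA]
  simp only [renewalDensity]
  rw [lintegral_tsum fun m => (measurable_convPow h.measurable_g m).aemeasurable]
  congr 1
  refine tsum_congr fun m => ?_
  have := h.map_lag 0 m
  rw [zero_add] at this
  rw [lagLaw, this, Measure.map_apply measurable_abs hA]
  exact withDensity_apply _ hA'

lemma IsRenewalSampling.lagMeasure_Iio_le {t : ℕ → Ω → ℝ} {g : ℝ → ℝ}
    (h : IsRenewalSampling P t g) {h₀ : ℝ} (hh₀ : ∀ s, renewalDensity g s ≤ ENNReal.ofReal h₀)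
    (M : ℝ) : lagMeasure P t (Set.Iio M) ≤ 2 * (ENNReal.ofReal h₀ * ENNReal.ofReal M) := by
  rw [h.lagMeasure_apply measurableSet_Iio]
  gcongr
  have hpre : MeasurableSet ((fun s : ℝ => |s|) ⁻¹' Set.Iio M) :=
    measurable_abs measurableSet_Iio
  calc ∫⁻ s in (fun s => |s|) ⁻¹' Set.Iio M, renewalDensity g s
      ≤ ∫⁻ s in (fun s => |s|) ⁻¹' Set.Iio M,
          (Set.Ico 0 M).indicator (fun _ => ENNReal.ofReal h₀) s := by
        refine setLIntegral_mono' hpre fun s hs => ?_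
        rcases lt_or_ge s 0 with hs0 | hs0
        · have : renewalDensity g s = 0 := by
            simp [renewalDensity, convPow_of_neg h.support_g _ hs0]
          rw [this]; exact zero_le
        · rw [Set.indicator_of_mem (Set.mem_Ico.2 ⟨hs0, (le_abs_self s).trans_lt hs⟩)]
          exact hh₀ s
    _ ≤ ∫⁻ s, (Set.Ico 0 M).indicator (fun _ => ENNReal.ofReal h₀) s :=
        lintegral_mono' Measure.restrict_le_self le_rfl
    _ = _ := by
        rw [lintegral_indicator measurableSet_Ico, setLIntegral_const, Real.volume_Ico, sub_zero]

/-! ### Jittered sampling -/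

lemma IsJitteredSampling.map_lag {t : ℕ → Ω → ℝ} {δ : ℝ} {gJ : ℝ → ℝ}
    (h : IsJitteredSampling P t δ gJ) (k m : ℕ) :
    P.map (fun ω => |t (k + (m + 1)) ω - t k ω|) =
      ((volume.withDensity (fun z => ENNReal.ofReal (gJ z))).prod
        (volume.withDensity (fun z => ENNReal.ofReal (gJ z)))).map
          (fun q => |(m + 1) * δ + (q.1 - q.2)|) := by
  obtain ⟨Z, hZ, hind, hlaw, ht⟩ := h.exists_noise
  have hpair := (indepFun_iff_map_prod_eq_prod_map_map (hZ (k + (m + 1))).aemeasurable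
    (hZ k).aemeasurable).1 (hind.indepFun (by omega : k + (m + 1) ≠ k))
  rw [hlaw, hlaw] at hpair
  rw [← hpair, Measure.map_map (by fun_prop) ((hZ _).prodMk (hZ _))]
  congr 1
  funext ω
  simp only [Function.comp_apply, ht]
  push_cast
  congr 1; ring

lemma IsJitteredSampling.stationaryLags {t : ℕ → Ω → ℝ} {δ : ℝ} {gJ : ℝ → ℝ}
    (h : IsJitteredSampling P t δ gJ) : StationaryLags P t := by
  intro k m
  have := h.map_lag 0 m
  rw [zero_add] at this
  rw [h.map_lag k m, lagLaw, this]

/-- Given one of the noises, two times coincide only if the other noise hits a single point, which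
is null for a law with a density. -/
lemma IsJitteredSampling.lagLaw_singleton_zero {t : ℕ → Ω → ℝ} {δ : ℝ} {gJ : ℝ → ℝ}
    (h : IsJitteredSampling P t δ gJ) (m : ℕ) : lagLaw P t (m + 1) {0} = 0 := by
  have hm := h.map_lag 0 m
  rw [zero_add] at hm
  have hmeas : Measurable fun q : ℝ × ℝ => |(m + 1) * δ + (q.1 - q.2)| := by fun_prop
  rw [lagLaw, hm, Measure.map_apply hmeas (measurableSet_singleton 0),
    Measure.measure_prod_null (hmeas (measurableSet_singleton 0))]
  refine ae_of_all _ fun z => ?_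
  refine measure_mono_null (t := {(m + 1) * δ + z}) (fun z' hz' => ?_) ?_
  · simp only [Set.mem_preimage, Set.mem_singleton_iff, abs_eq_zero] at hz' ⊢
    linarith
  · exact (withDensity_absolutelyContinuous _ _) (by simp)

lemma IsJitteredSampling.lagMeasure_Iio_le {t : ℕ → Ω → ℝ} {δ : ℝ} {gJ : ℝ → ℝ}
    (h : IsJitteredSampling P t δ gJ) (M : ℝ) :
    lagMeasure P t (Set.Iio M) ≤ 2 * (⌈M / δ⌉₊ : ℝ≥0∞) := by
  rw [lagMeasure, Measure.smul_apply, smul_eq_mul, Measure.sum_apply _ measurableSet_Iio]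
  gcongr
  rw [tsum_eq_sum (s := Finset.range ⌈M / δ⌉₊)]
  · calc ∑ m ∈ Finset.range ⌈M / δ⌉₊, lagLaw P t (m + 1) (Set.Iio M)
        ≤ ∑ m ∈ Finset.range ⌈M / δ⌉₊, 1 := by
          refine Finset.sum_le_sum fun m _ => ?_
          have : IsProbabilityMeasure (lagLaw P t (m + 1)) :=
            Measure.isProbabilityMeasure_map
              (measurable_lag h.measurable 0 _).aemeasurable
          exact prob_le_one
      _ = _ := by simp
  · intro m hm
    rw [Finset.mem_range, not_lt] at hm
    refine h.lagLaw_Iio ?_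
    rw [← div_le_iff₀ h.pos_δ]
    exact (Nat.le_ceil _).trans (by exact_mod_cast hm)

/-! ### Both designs -/

/-- The properties of the lag measure that are used for both designs. -/
lemma IsDesignConstant.lagMeasure_spec {t : ℕ → Ω → ℝ} {u₀ C : ℝ} (hu₀ : 0 < u₀)
    (hC : IsDesignConstant P t u₀ C) :
    (∀ k, Measurable (t k)) ∧ 0 ≤ C ∧ StationaryLags P t ∧ lagMeasure P t {0} = 0 ∧
      lagMeasure P t (Set.Iio u₀) ≤ ENNReal.ofReal C ∧
      ∃ A : ℝ, 0 ≤ A ∧ ∀ M, 0 ≤ M →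
        lagMeasure P t (Set.Iio M) ≤ ENNReal.ofReal (A * (M + 1)) := by
  rcases hC with ⟨g, h₀, h, hh₀, rfl⟩ | ⟨δ, gJ, h, rfl⟩
  -- `ENNReal.ofReal` truncates at zero, so the sign of `h₀` has to be known. It follows from `g 1 >
  -- 0`, since `g` is the first term of the renewal density.
  · have hpos : 0 < h₀ := by
      have h1 : ENNReal.ofReal (g 1) ≤ ENNReal.ofReal h₀ :=
        le_trans (ENNReal.le_tsum (f := fun k => convPow g k 1) 0) (hh₀ 1)
      have h2 := h.pos_g 1 one_pos
      exact ENNReal.ofReal_pos.1 ((ENNReal.ofReal_pos.2 h2).trans_le h1)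
    have h2 : (2 : ℝ≥0∞) = ENNReal.ofReal 2 := by simp
    refine ⟨h.measurable, by positivity, h.stationaryLags, ?_, ?_, 2 * h₀, by positivity,
      fun M hM => ?_⟩
    · rw [h.lagMeasure_apply (measurableSet_singleton 0)]
      have : (fun s : ℝ => |s|) ⁻¹' {0} = {0} := by ext; simp
      rw [this]; simp
    · refine (h.lagMeasure_Iio_le hh₀ u₀).trans (le_of_eq ?_)
      rw [h2, ← ENNReal.ofReal_mul hpos.le, ← ENNReal.ofReal_mul zero_le_two]
      congr 1; ring
    · refine (h.lagMeasure_Iio_le hh₀ M).trans ?_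
      rw [h2, ← ENNReal.ofReal_mul hpos.le, ← ENNReal.ofReal_mul zero_le_two]
      exact ENNReal.ofReal_le_ofReal (by nlinarith)
  · have hδ := h.pos_δ
    have key : ∀ M : ℝ, 0 ≤ M → (2 * (⌈M / δ⌉₊ : ℝ≥0∞)) =
        ENNReal.ofReal (2 * (⌈M / δ⌉₊ : ℝ)) := fun M _ => by
      rw [ENNReal.ofReal_mul zero_le_two, ENNReal.ofReal_natCast]; simp
    refine ⟨h.measurable, ?_, h.stationaryLags, ?_, ?_, 2 * (1 / δ + 1), by positivity,
      fun M hM => ?_⟩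
    · have : (0 : ℤ) ≤ ⌈u₀ / δ⌉ := Int.ceil_nonneg (by positivity)
      have : (0 : ℝ) ≤ ⌈u₀ / δ⌉ := by exact_mod_cast this
      positivity
    · rw [lagMeasure, Measure.smul_apply, smul_eq_mul,
        Measure.sum_apply _ (measurableSet_singleton 0)]
      simp [h.lagLaw_singleton_zero]
    · refine (h.lagMeasure_Iio_le u₀).trans (le_of_eq ?_)
      rw [key u₀ hu₀.le, natCast_ceil_eq_intCast_ceil (by positivity)]
    · refine (h.lagMeasure_Iio_le M).trans ?_
      rw [key M hM]
      refine ENNReal.ofReal_le_ofReal ?_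
      have := (Nat.ceil_lt_add_one (div_nonneg hM hδ.le)).le
      have h1 : 0 ≤ 1 / δ := by positivity
      rw [div_eq_mul_one_div] at this ⊢
      nlinarith

end

/-! ### Conditioning on the sampling times -/

section

variable {Ω : Type*}

/-- Fubini for the product law. The target of `ξ` has its own σ-algebra because the lemma is applied
to the identity of `Ω`, from the ambient σ-algebra to `𝒢`. -/
lemma integral_eq_of_indepFun [MeasurableSpace Ω] {P : Measure Ω} [IsProbabilityMeasure P]
    {Ω' E : Type*} {mΩ' : MeasurableSpace Ω'} {mE : MeasurableSpace E}
    {ξ : Ω → Ω'} {T : Ω → E} (hξ : Measurable ξ) (hT : Measurable T) (hind : IndepFun T ξ P)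
    {F : E → Ω' → ℝ} (hF : Measurable (Function.uncurry F)) (hF1 : ∀ e ω, |F e ω| ≤ 1) :
    ∫ ω, F (T ω) (ξ ω) ∂P = ∫ ω', ∫ ω, F (T ω') (ξ ω) ∂P ∂P := by
  have hprod := (indepFun_iff_map_prod_eq_prod_map_map hT.aemeasurable hξ.aemeasurable).1 hind
  have : IsProbabilityMeasure (P.map T) := Measure.isProbabilityMeasure_map hT.aemeasurable
  have : IsProbabilityMeasure (P.map ξ) := Measure.isProbabilityMeasure_map hξ.aemeasurable
  have hint : Integrable (Function.uncurry F) ((P.map T).prod (P.map ξ)) :=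
    Integrable.of_bound hF.aestronglyMeasurable 1 (ae_of_all _ fun q => hF1 q.1 q.2)
  calc ∫ ω, F (T ω) (ξ ω) ∂P = ∫ q, Function.uncurry F q ∂(P.map fun ω => (T ω, ξ ω)) := by
        rw [integral_map (hT.prodMk hξ).aemeasurable hF.aestronglyMeasurable]; rfl
    _ = ∫ e, ∫ ω', F e ω' ∂(P.map ξ) ∂(P.map T) := by rw [hprod, integral_prod _ hint]; rfl
    _ = ∫ ω', ∫ v, F (T ω') v ∂(P.map ξ) ∂P := by
        rw [integral_map hT.aemeasurable]
        exact (hF.stronglyMeasurable.integral_prod_right').aestronglyMeasurable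
    _ = _ := by
        congr 1; funext ω'
        rw [integral_map hξ.aemeasurable]
        exact (hF.comp (measurable_const.prodMk measurable_id)).aestronglyMeasurable

variable [mΩ : MeasurableSpace Ω] {P : Measure Ω} {X : ℝ → Ω → ℝ} {t : ℕ → Ω → ℝ}

lemma IndependentTimes.measurable_uncurry (h : IndependentTimes P X t) :
    Measurable (Function.uncurry X) := by
  obtain ⟨𝒢, h𝒢, hX, -⟩ := h
  exact hX.mono (sup_le_sup le_rfl (MeasurableSpace.comap_mono h𝒢)) le_rfl

variable {f : ℝ → ℝ} {f₂ : ℝ → ℝ × ℝ → ℝ}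

/-- No integrability is required: the Bochner integral of a non-integrable function is `0`. -/
lemma ofReal_integral_le_lintegral_ofReal {g : Ω → ℝ} :
    ENNReal.ofReal (∫ ω, g ω ∂P) ≤ ∫⁻ ω, ENNReal.ofReal (g ω) ∂P := by
  by_cases hg : Integrable g P
  · rw [integral_eq_lintegral_pos_part_sub_lintegral_neg_part hg]
    exact (ENNReal.ofReal_le_ofReal (sub_le_self _ ENNReal.toReal_nonneg)).trans
      ENNReal.ofReal_toReal_le
  · rw [integral_undef hg, ENNReal.ofReal_zero]; exact zero_le

lemma ofReal_sum_le {ι : Type*} (s : Finset ι) (g : ι → ℝ) :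
    ENNReal.ofReal (∑ i ∈ s, g i) ≤ ∑ i ∈ s, ENNReal.ofReal (g i) :=
  Finset.le_sum_of_subadditive _ ENNReal.ofReal_zero.le (fun _ _ => ENNReal.ofReal_add_le) _ _

lemma integral_comp_eq (hX : HasStationaryDensities P X f f₂) {ψ : ℝ → ℝ} (hψ : Measurable ψ)
    (s t : ℝ) : ∫ ω, ψ (X s ω) ∂P = ∫ ω, ψ (X t ω) ∂P := by
  rw [← integral_map (hX.measurable_X s).aemeasurable hψ.aestronglyMeasurable,
    ← integral_map (hX.measurable_X t).aemeasurable hψ.aestronglyMeasurable, hX.map_eq s,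
    hX.map_eq t]

lemma IndependentTimes.measurable_obs (h : IndependentTimes P X t) (ht : ∀ k, Measurable (t k))
    (k : ℕ) : Measurable fun ω => X (t k ω) ω :=
  h.measurable_uncurry.comp ((ht k).prodMk measurable_id)

variable [IsProbabilityMeasure P]

/-- Expectations of the process at two sampling times, with an independent copy of the times. -/
lemma IndependentTimes.integral_eq (h : IndependentTimes P X t) (ht : ∀ k, Measurable (t k))
    {ψ : ℝ × ℝ → ℝ} (hψ : Measurable ψ) (hψ1 : ∀ q, |ψ q| ≤ 1) (k l : ℕ) :
    ∫ ω, ψ (X (t k ω) ω, X (t l ω) ω) ∂P =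
      ∫ ω', ∫ ω, ψ (X (t k ω') ω, X (t l ω') ω) ∂P ∂P := by
  have hT : Measurable fun ω => (t k ω, t l ω) := (ht k).prodMk (ht l)
  obtain ⟨𝒢, h𝒢, hX, hind⟩ := h
  have hle : MeasurableSpace.comap (fun ω => (t k ω, t l ω)) inferInstance ≤
      ⨆ k, MeasurableSpace.comap (t k) inferInstance := by
    rw [← measurable_iff_comap_le]
    have hk : ∀ k, Measurable[⨆ k, MeasurableSpace.comap (t k) inferInstance] (t k) := fun k =>
      measurable_iff_comap_le.2
        (le_iSup (fun k => MeasurableSpace.comap (t k) inferInstance) k)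
    exact @Measurable.prodMk _ _ _ _ _ (_) _ _ (hk k) (hk l)
  have hind' : @IndepFun Ω Ω (ℝ × ℝ) mΩ 𝒢 _ id (fun ω => (t k ω, t l ω)) P := by
    rw [IndepFun_iff_Indep, MeasurableSpace.comap_id]
    exact indep_of_indep_of_le_right hind hle
  refine @integral_eq_of_indepFun Ω mΩ P _ Ω (ℝ × ℝ) 𝒢 _ id (fun ω => (t k ω, t l ω))
    (measurable_id'' h𝒢) hT hind'.symm (fun e ω => ψ (X e.1 ω, X e.2 ω)) ?_ (fun e ω => hψ1 _)
  -- Stated on a generic space, so that measurability is proved with a single σ-algebra in scope and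
  -- then specialized to `𝒢`.
  have aux : ∀ (Ω' : Type _) (mΩ' : MeasurableSpace Ω') (X' : ℝ → Ω' → ℝ),
      Measurable (Function.uncurry X') →
      Measurable (Function.uncurry fun (e : ℝ × ℝ) (ω : Ω') => ψ (X' e.1 ω, X' e.2 ω)) := by
    intro Ω' mΩ' X' hX'
    exact hψ.comp ((hX'.comp ((measurable_fst.comp measurable_fst).prodMk measurable_snd)).prodMk
      (hX'.comp ((measurable_snd.comp measurable_fst).prodMk measurable_snd)))
  exact aux Ω 𝒢 X hX

lemma measurable_polyKernel_right (a h x : ℝ) : Measurable (polyKernel a h x) :=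
  (measurable_polyKernel a h).comp (measurable_const.prodMk measurable_id)

lemma abs_polyKernel_le_one {a h : ℝ} (hh : 0 < h) (x y : ℝ) : |polyKernel a h x y| ≤ 1 := by
  rw [abs_of_nonneg (polyKernel_nonneg _ _ _ _)]
  exact polyKernel_le_one hh x y

/-- Given the times, the mean does not depend on them, because all `X t` have the same law. -/
lemma integral_polyKernel_obs (hX : HasStationaryDensities P X f f₂) (h : IndependentTimes P X t)
    (ht : ∀ k, Measurable (t k)) {a b : ℝ} (hb : 0 < b) (x : ℝ) (k : ℕ) :
    ∫ ω, polyKernel a b x (X (t k ω) ω) ∂P = ∫ ω, polyKernel a b x (X 0 ω) ∂P := by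
  have := h.integral_eq ht (ψ := fun q => polyKernel a b x q.1)
    ((measurable_polyKernel_right a b x).comp measurable_fst)
    (fun q => abs_polyKernel_le_one hb x _) k k
  simp only at this
  rw [this]
  simp_rw [integral_comp_eq hX (measurable_polyKernel_right a b x) _ 0]
  simp

lemma kernelCov_eq (hX : HasStationaryDensities P X f f₂) {a b : ℝ} (hb : 0 < b) (x s u : ℝ) :
    kernelCov P X a b x s u = ∫ ω, polyKernel a b x (X s ω) * polyKernel a b x (X u ω) ∂P -
      (∫ ω, polyKernel a b x (X 0 ω) ∂P) * ∫ ω, polyKernel a b x (X 0 ω) ∂P := by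
  rw [kernelCov, covariance_eq_sub (memLp_polyKernel (hX.measurable_X s) hb x)
    (memLp_polyKernel (hX.measurable_X u) hb x),
    integral_comp_eq hX (measurable_polyKernel_right a b x) s 0,
    integral_comp_eq hX (measurable_polyKernel_right a b x) u 0]
  rfl

lemma measurable_polyKernel_of {α : Type*} [MeasurableSpace α] {u v : α → ℝ} (a h : ℝ)
    (hu : Measurable u) (hv : Measurable v) : Measurable fun q => polyKernel a h (u q) (v q) :=
  (measurable_polyKernel a h).comp (f := fun q => (u q, v q)) (hu.prodMk hv)

lemma measurable_process_of {α : Type*} [MeasurableSpace α] (hX : Measurable (Function.uncurry X))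
    {u : α → ℝ} {v : α → Ω} (hu : Measurable u) (hv : Measurable v) :
    Measurable fun q => X (u q) (v q) :=
  hX.comp (f := fun q => (u q, v q)) (hu.prodMk hv)

lemma measurable_kernelCov (hX : HasStationaryDensities P X f f₂) (h : IndependentTimes P X t)
    {a b : ℝ} (hb : 0 < b) :
    Measurable fun q : ℝ × ℝ × ℝ => kernelCov P X a b q.1 q.2.1 q.2.2 := by
  have hXm := h.measurable_uncurry
  simp_rw [kernelCov_eq hX hb]
  refine Measurable.sub ?_ ?_
  · refine (StronglyMeasurable.integral_prod_right' (f := fun q : (ℝ × ℝ × ℝ) × Ω =>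
      polyKernel a b q.1.1 (X q.1.2.1 q.2) * polyKernel a b q.1.1 (X q.1.2.2 q.2)) ?_).measurable
    refine Measurable.stronglyMeasurable (Measurable.mul ?_ ?_)
    · exact measurable_polyKernel_of a b (by fun_prop) (measurable_process_of hXm (by fun_prop)
        measurable_snd)
    · exact measurable_polyKernel_of a b (by fun_prop) (measurable_process_of hXm (by fun_prop)
        measurable_snd)
  · have : Measurable fun q : ℝ × ℝ × ℝ => ∫ ω, polyKernel a b q.1 (X 0 ω) ∂P := by
      refine (StronglyMeasurable.integral_prod_right' (f := fun q : (ℝ × ℝ × ℝ) × Ω =>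
        polyKernel a b q.1.1 (X 0 q.2)) ?_).measurable
      exact (measurable_polyKernel_of a b (by fun_prop)
        ((hX.measurable_X 0).comp measurable_snd)).stronglyMeasurable
    exact this.mul this

/-- This is the law of total covariance. Its second term, the covariance of the conditional means,
vanishes because these means are constant. -/
lemma cov_obs_eq (hX : HasStationaryDensities P X f f₂) (h : IndependentTimes P X t)
    (ht : ∀ k, Measurable (t k)) {a b : ℝ} (hb : 0 < b) (x : ℝ) (k l : ℕ) :
    cov[fun ω => polyKernel a b x (X (t k ω) ω), fun ω => polyKernel a b x (X (t l ω) ω); P] =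
      ∫ ω, kernelCov P X a b x (t k ω) (t l ω) ∂P := by
  have hφ := measurable_polyKernel_right a b x
  set c := ∫ ω, polyKernel a b x (X 0 ω) ∂P with hc
  set e : Ω → ℝ := fun ω' => ∫ ω, polyKernel a b x (X (t k ω') ω) *
      polyKernel a b x (X (t l ω') ω) ∂P with he
  have hbd : ∀ y z, |polyKernel a b x y * polyKernel a b x z| ≤ 1 := fun y z => by
    rw [abs_mul]
    exact mul_le_one₀ (abs_polyKernel_le_one hb _ _) (abs_nonneg _) (abs_polyKernel_le_one hb _ _)
  have hcov : ∀ ω', kernelCov P X a b x (t k ω') (t l ω') = e ω' - c * c := fun ω' =>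
    kernelCov_eq hX hb x _ _
  have hpair : ∫ ω, polyKernel a b x (X (t k ω) ω) * polyKernel a b x (X (t l ω) ω) ∂P =
      ∫ ω', e ω' ∂P :=
    h.integral_eq ht (ψ := fun q => polyKernel a b x q.1 * polyKernel a b x q.2)
      ((hφ.comp measurable_fst).mul (hφ.comp measurable_snd)) (fun q => hbd _ _) k l
  have hm : Measurable fun ω' => kernelCov P X a b x (t k ω') (t l ω') :=
    Measurable.comp (g := fun q : ℝ × ℝ × ℝ => kernelCov P X a b q.1 q.2.1 q.2.2)
      (f := fun ω' => (x, t k ω', t l ω')) (measurable_kernelCov hX h hb)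
      (measurable_const.prodMk ((ht k).prodMk (ht l)))
  have hme : Measurable e := by
    have : e = fun ω' => kernelCov P X a b x (t k ω') (t l ω') + c * c := by
      funext ω'; rw [hcov, sub_add_cancel]
    rw [this]; exact hm.add_const _
  have hint : Integrable e P := by
    refine Integrable.of_bound hme.aestronglyMeasurable 1 (ae_of_all _ fun ω' => ?_)
    have := norm_integral_le_of_norm_le_const (μ := P) (C := 1) (f := fun ω =>
      polyKernel a b x (X (t k ω') ω) * polyKernel a b x (X (t l ω') ω))
      (ae_of_all _ fun ω => hbd _ _)
    simpa using this
  rw [covariance_eq_sub (memLp_polyKernel (h.measurable_obs ht k) hb x)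
    (memLp_polyKernel (h.measurable_obs ht l) hb x), integral_polyKernel_obs hX h ht hb,
    integral_polyKernel_obs hX h ht hb, ← hc]
  simp_rw [hcov]
  rw [integral_sub hint (integrable_const _), ← hpair]
  simp

/-- An upper bound suffices, so negative covariances are discarded. The remaining integrands are
nonnegative and can be exchanged by Tonelli. -/
lemma evariance_estimator_le (hX : HasStationaryDensities P X f f₂) (h : IndependentTimes P X t)
    (ht : ∀ k, Measurable (t k)) {a b : ℝ} (hb : 0 < b) (n : ℕ) (x : ℝ) :
    evariance (fun ω => estimator X t a b n ω x) P ≤ ENNReal.ofReal ((1 / (n * b)) ^ 2) *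
      ∑ k ∈ Finset.Icc 1 n, ∑ l ∈ Finset.Icc 1 n,
        ∫⁻ ω, ENNReal.ofReal (kernelCov P X a b x (t k ω) (t l ω)) ∂P := by
  have hm : ∀ k, MemLp (fun ω => polyKernel a b x (X (t k ω) ω)) 2 P := fun k =>
    memLp_polyKernel (h.measurable_obs ht k) hb x
  simp only [estimator, freqPoly_eq hb]
  rw [evariance_mul]
  gcongr
  have hs : (fun ω => ∑ k ∈ Finset.Icc 1 n, polyKernel a b x (X (t k ω) ω)) =
      ∑ k ∈ Finset.Icc 1 n, fun ω => polyKernel a b x (X (t k ω) ω) := by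
    funext ω; simp
  rw [hs, ← ofReal_variance (memLp_finsetSum' _ fun k _ => hm k), variance_sum' fun k _ => hm k]
  refine (ofReal_sum_le _ _).trans (Finset.sum_le_sum fun k _ => ?_)
  refine (ofReal_sum_le _ _).trans (Finset.sum_le_sum fun l _ => ?_)
  rw [cov_obs_eq hX h ht hb]
  exact ofReal_integral_le_lintegral_ofReal

lemma intVar_estimator_le (hX : HasStationaryDensities P X f f₂) (h : IndependentTimes P X t)
    (ht : ∀ k, Measurable (t k)) {a b : ℝ} (hb : 0 < b) (n : ℕ) :
    intVar P (estimator X t a b n) ≤ ENNReal.ofReal ((1 / (n * b)) ^ 2) *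
      ∑ k ∈ Finset.Icc 1 n, ∑ l ∈ Finset.Icc 1 n,
        ∫⁻ ω, (∫⁻ x, ENNReal.ofReal (kernelCov P X a b x (t k ω) (t l ω))) ∂P := by
  have hm : ∀ k l, Measurable fun q : ℝ × Ω =>
      ENNReal.ofReal (kernelCov P X a b q.1 (t k q.2) (t l q.2)) := fun k l =>
    (Measurable.comp (g := fun q : ℝ × ℝ × ℝ => kernelCov P X a b q.1 q.2.1 q.2.2)
      (f := fun q : ℝ × Ω => (q.1, t k q.2, t l q.2)) (measurable_kernelCov hX h hb)
      (measurable_fst.prodMk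
        (((ht k).comp measurable_snd).prodMk ((ht l).comp measurable_snd)))).ennreal_ofReal
  refine (lintegral_mono fun x => evariance_estimator_le hX h ht hb n x).trans (le_of_eq ?_)
  rw [lintegral_const_mul']
  · congr 1
    rw [lintegral_finsetSum _ fun k _ => Finset.measurable_fun_sum _ fun l _ =>
      (hm k l).lintegral_prod_right']
    refine Finset.sum_congr rfl fun k _ => ?_
    rw [lintegral_finsetSum _ fun l _ => (hm k l).lintegral_prod_right']
    refine Finset.sum_congr rfl fun l _ => ?_
    exact lintegral_lintegral_swap (f := fun x ω =>
      ENNReal.ofReal (kernelCov P X a b x (t k ω) (t l ω))) (hm k l).aemeasurable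
  · exact ENNReal.ofReal_ne_top

end

/-! ### The integrated variance -/

section

/-- The integrals of `u ^ (-ρ)` against a measure of linear growth. -/
lemma lintegral_rpow_neg_lt_top {ν : Measure ℝ} {A : ℝ} (hA : 0 ≤ A)
    (hν : ∀ M, 0 ≤ M → ν (Set.Iio M) ≤ ENNReal.ofReal (A * (M + 1))) {ρ u₁ : ℝ} (hρ : 2 < ρ)
    (hu₁ : 0 < u₁) : ∫⁻ u in Set.Ici u₁, ENNReal.ofReal (u ^ (-ρ)) ∂ν < ∞ := by
  set S : ℕ → Set ℝ := fun m => Set.Ico (m + u₁) (m + u₁ + 1) with hS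
  have hcov : Set.Ici u₁ ⊆ ⋃ m, S m := by
    intro u hu
    have hu' : 0 ≤ u - u₁ := sub_nonneg.2 hu
    refine Set.mem_iUnion.2 ⟨⌊u - u₁⌋₊, ?_, ?_⟩
    · linarith [Nat.floor_le hu']
    · linarith [Nat.lt_floor_add_one (u - u₁)]
  -- The mass of a unit block is bounded crudely by that of the whole half-line to the left of its
  -- right end, which is of order `m`. The block terms are then of order `m ^ (1 - ρ)`, summable
  -- since `ρ > 2`. The factor `1 + 2 / u₁` comes from `m + u₁ + 2 ≤ (1 + 2 / u₁) (m + u₁)`.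
  set c := A * (1 + 2 / u₁) with hc
  have hterm : ∀ m, ∫⁻ u in S m, ENNReal.ofReal (u ^ (-ρ)) ∂ν ≤
      ENNReal.ofReal (c * (1 / |(m : ℝ) + u₁| ^ (ρ - 1))) := by
    intro m
    have hpos : 0 < (m : ℝ) + u₁ := by positivity
    have hm0 : (0 : ℝ) ≤ m := m.cast_nonneg
    calc ∫⁻ u in S m, ENNReal.ofReal (u ^ (-ρ)) ∂ν
        ≤ ∫⁻ _ in S m, ENNReal.ofReal ((m + u₁) ^ (-ρ)) ∂ν := by
          refine setLIntegral_mono measurable_const fun u hu => ENNReal.ofReal_le_ofReal ?_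
          exact Real.rpow_le_rpow_of_nonpos hpos hu.1 (by linarith)
      _ ≤ ENNReal.ofReal ((m + u₁) ^ (-ρ)) * ENNReal.ofReal (A * (m + u₁ + 1 + 1)) := by
          rw [setLIntegral_const]
          gcongr
          exact (measure_mono fun u hu => hu.2).trans (hν _ (by positivity))
      _ = ENNReal.ofReal ((m + u₁) ^ (-ρ) * (A * (m + u₁ + 1 + 1))) := by
          rw [← ENNReal.ofReal_mul (by positivity)]
      _ ≤ _ := by
          refine ENNReal.ofReal_le_ofReal ?_
          have e1 : 1 / |(m : ℝ) + u₁| ^ (ρ - 1) = (m + u₁) ^ (-ρ) * (m + u₁) := by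
            rw [abs_of_pos hpos, one_div, ← Real.rpow_neg hpos.le, ← Real.rpow_add_one hpos.ne']
            congr 1; ring
          rw [e1]
          have h1 : (m : ℝ) + u₁ + 1 + 1 ≤ (1 + 2 / u₁) * (m + u₁) := by
            have : (2 : ℝ) / u₁ * (m + u₁) = 2 / u₁ * m + 2 := by field_simp
            have h2 : 0 ≤ 2 / u₁ * (m : ℝ) := by positivity
            linarith
          have h3 : 0 ≤ ((m : ℝ) + u₁) ^ (-ρ) := by positivity
          calc ((m : ℝ) + u₁) ^ (-ρ) * (A * (m + u₁ + 1 + 1))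
              ≤ (m + u₁) ^ (-ρ) * (A * ((1 + 2 / u₁) * (m + u₁))) := by gcongr
            _ = _ := by rw [hc]; ring
  have hsum : Summable fun m : ℕ => c * (1 / |(m : ℝ) + u₁| ^ (ρ - 1)) :=
    ((Real.summable_one_div_nat_add_rpow u₁ (ρ - 1)).2 (by linarith)).mul_left c
  calc ∫⁻ u in Set.Ici u₁, ENNReal.ofReal (u ^ (-ρ)) ∂ν
      ≤ ∫⁻ u in ⋃ m, S m, ENNReal.ofReal (u ^ (-ρ)) ∂ν := lintegral_mono_set hcov
    _ ≤ ∑' m, ∫⁻ u in S m, ENNReal.ofReal (u ^ (-ρ)) ∂ν := lintegral_iUnion_le _ _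
    _ ≤ ∑' m : ℕ, ENNReal.ofReal (c * (1 / |(m : ℝ) + u₁| ^ (ρ - 1))) :=
        ENNReal.tsum_le_tsum hterm
    _ < ∞ := by
        rw [← ENNReal.ofReal_tsum_of_nonneg (fun m => by positivity) hsum]
        exact ENNReal.ofReal_lt_top

/-- A bound for the total covariance at lag `u ≥ u₀`, divided by the bin width `b`. -/
noncomputable def lagBound (K a₀ u₁ ρ b u : ℝ) : ℝ≥0∞ :=
  min (4 * (ENNReal.ofReal b * ENNReal.ofReal K))
    (if u < u₁ then ∞ else 4 * ENNReal.ofReal (4 * (a₀ * u ^ (-ρ))))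

lemma measurable_lagBound (K a₀ u₁ ρ b : ℝ) : Measurable (lagBound K a₀ u₁ ρ b) := by
  refine measurable_const.min (Measurable.ite measurableSet_Iio measurable_const ?_)
  fun_prop

/-- Dominated convergence: the density bound gives the pointwise limit, and the value at `b = 1`
dominates, being bounded below `u₁` and of order `u ^ (-ρ)` beyond. -/
lemma tendsto_lintegral_lagBound {ν : Measure ℝ} {A : ℝ} (hA : 0 ≤ A)
    (hν : ∀ M, 0 ≤ M → ν (Set.Iio M) ≤ ENNReal.ofReal (A * (M + 1))) {K a₀ ρ u₀ u₁ : ℝ}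
    (ha₀ : 0 < a₀) (hρ : 2 < ρ) (hu₁ : 0 < u₁) :
    Tendsto (fun b => ∫⁻ u in Set.Ici u₀, lagBound K a₀ u₁ ρ b u ∂ν) (𝓝[>] 0) (𝓝 0) := by
  have hlim : Tendsto (fun b : ℝ => 4 * (ENNReal.ofReal b * ENNReal.ofReal K)) (𝓝[>] 0)
      (𝓝 0) := by
    have h1 : Tendsto (fun b : ℝ => ENNReal.ofReal b) (𝓝[>] 0) (𝓝 0) := by
      have := (ENNReal.continuous_ofReal.tendsto 0).mono_left (nhdsWithin_le_nhds (s := Set.Ioi 0))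
      simpa using this
    have h2 := ENNReal.Tendsto.const_mul (a := 4) (ENNReal.Tendsto.mul_const
      (b := ENNReal.ofReal K) h1 (Or.inr ENNReal.ofReal_ne_top)) (Or.inr (by simp))
    simpa using h2
  have h0 : (0 : ℝ≥0∞) = ∫⁻ _ in Set.Ici u₀, 0 ∂ν := by simp
  rw [h0]
  refine tendsto_lintegral_filter_of_dominated_convergence (lagBound K a₀ u₁ ρ 1)
    (Eventually.of_forall fun b => measurable_lagBound K a₀ u₁ ρ b) ?_ ?_ ?_
  · have : ∀ᶠ b : ℝ in 𝓝[>] 0, b ≤ 1 :=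
      nhdsWithin_le_nhds (eventually_le_nhds one_pos)
    filter_upwards [this] with b hb
    refine ae_of_all _ fun u => ?_
    unfold lagBound
    gcongr
  · have hpt : ∀ u, lagBound K a₀ u₁ ρ 1 u ≤
        (Set.Iio u₁).indicator (fun _ => 4 * ENNReal.ofReal K) u +
          (Set.Ici u₁).indicator
            (fun u => 4 * ENNReal.ofReal (4 * a₀) * ENNReal.ofReal (u ^ (-ρ))) u := by
      intro u
      unfold lagBound
      rcases lt_or_ge u u₁ with hu | hu
      · rw [Set.indicator_of_mem (Set.mem_Iio.2 hu),
          Set.indicator_of_notMem (by simpa using hu), add_zero]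
        simp
      · rw [Set.indicator_of_notMem (by simpa using hu), Set.indicator_of_mem (Set.mem_Ici.2 hu),
          zero_add, if_neg (not_lt.2 hu), mul_assoc,
          ← ENNReal.ofReal_mul (p := 4 * a₀) (by positivity), mul_assoc 4 a₀]
        exact min_le_right _ _
    refine ne_of_lt ((lintegral_mono hpt).trans_lt ?_)
    refine (lintegral_mono' Measure.restrict_le_self le_rfl).trans_lt ?_
    rw [lintegral_add_left (measurable_const.indicator measurableSet_Iio),
      lintegral_indicator measurableSet_Iio, lintegral_indicator measurableSet_Ici,
      setLIntegral_const, lintegral_const_mul _ (by fun_prop)]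
    refine ENNReal.add_lt_top.2 ⟨ENNReal.mul_lt_top (ENNReal.mul_lt_top (by simp)
      ENNReal.ofReal_lt_top) ((hν u₁ hu₁.le).trans_lt ENNReal.ofReal_lt_top),
      ENNReal.mul_lt_top (ENNReal.mul_lt_top (by simp) ENNReal.ofReal_lt_top)
        (lintegral_rpow_neg_lt_top hA hν hρ hu₁)⟩
  · refine ae_of_all _ fun u => ?_
    exact tendsto_of_tendsto_of_tendsto_of_le_of_le tendsto_const_nhds hlim
      (fun _ => zero_le) (fun _ => min_le_left _ _)

variable {Ω : Type*} [MeasurableSpace Ω] {P : Measure Ω} [IsProbabilityMeasure P]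
  {X : ℝ → Ω → ℝ} {t : ℕ → Ω → ℝ} {f : ℝ → ℝ} {f₂ : ℝ → ℝ × ℝ → ℝ}

/-- Finite sample bound for the integrated variance of the frequency polygon. -/
lemma mul_intVar_le (hX : HasStationaryDensities P X f f₂) (h : IndependentTimes P X t)
    (ht : ∀ k, Measurable (t k)) (hstat : StationaryLags P t) (h0 : lagMeasure P t {0} = 0)
    {u₀ : ℝ} {a b : ℝ} (hb : 0 < b) {n : ℕ} (hn : 0 < n) {R : ℝ → ℝ≥0∞} (hR : Measurable R)
    (hD : ∀ s u, s ≠ u → u₀ ≤ |u - s| → ∫⁻ x, ENNReal.ofReal (kernelCov P X a b x s u) ≤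
      ENNReal.ofReal b * R |u - s|) :
    ENNReal.ofReal (n * b) * intVar P (estimator X t a b n) ≤
      ENNReal.ofReal (2 / 3) + ENNReal.ofReal (2 / 3) * lagMeasure P t (Set.Iio u₀) +
        ∫⁻ u in Set.Ici u₀, R u ∂(lagMeasure P t) := by
  set ν := lagMeasure P t with hν
  -- A bound, as a function of the lag alone, for the covariance integrated over `x` at distinct
  -- times.
  set ψ : ℝ → ℝ≥0∞ := fun u => (Set.Iio u₀).indicator (fun _ => ENNReal.ofReal (2 / 3 * b)) u +
    ENNReal.ofReal b * (Set.Ici u₀).indicator R u with hψ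
  have hψm : Measurable ψ := (measurable_const.indicator measurableSet_Iio).add
    ((hR.indicator measurableSet_Ici).const_mul _)
  set D : ℕ → ℕ → ℝ≥0∞ := fun k l =>
    ∫⁻ ω, (∫⁻ x, ENNReal.ofReal (kernelCov P X a b x (t k ω) (t l ω))) ∂P with hDdef
  have hoff : ∀ k ∈ Finset.Icc 1 n, ∀ l ∈ (Finset.Icc 1 n).erase k,
      D k l ≤ ∫⁻ ω, ψ |t l ω - t k ω| ∂P := by
    intro k hk l hl
    -- No sign of `u₀` is assumed here, so coincidence of two times is excluded through the null
    -- mass of the lag measure at `0`.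
    have hzero : ∀ᵐ ω ∂P, t k ω ≠ t l ω := by
      have h1 := sum_lintegral_lag_le ht hstat (ψ := Set.indicator {0} fun _ => 1)
        (measurable_const.indicator (measurableSet_singleton 0)) n
      rw [lintegral_indicator (measurableSet_singleton 0), setLIntegral_const, h0, mul_zero,
        mul_zero, nonpos_iff_eq_zero, Finset.sum_eq_zero_iff] at h1
      have h2 := Finset.sum_eq_zero_iff.1 (h1 k hk) l hl
      have hm : Measurable fun ω => Set.indicator {0} (fun _ => (1 : ℝ≥0∞)) |t l ω - t k ω| :=
        (measurable_const.indicator (measurableSet_singleton 0)).comp (measurable_lag ht k l)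
      filter_upwards [(lintegral_eq_zero_iff hm).1 h2] with ω hω heq
      simp [heq] at hω
    refine lintegral_mono_ae ?_
    filter_upwards [hzero] with ω hω
    rcases lt_or_ge |t l ω - t k ω| u₀ with hlt | hge
    · refine (lintegral_kernelCov_le hX.measurable_X hb _ _).trans ?_
      simp only [hψ]
      rw [Set.indicator_of_mem (Set.mem_Iio.2 hlt)]
      exact le_self_add
    · refine (hD _ _ hω hge).trans ?_
      simp only [hψ]
      rw [Set.indicator_of_mem (Set.mem_Ici.2 hge)]
      exact le_add_self
  have hsum : ∑ k ∈ Finset.Icc 1 n, ∑ l ∈ Finset.Icc 1 n, D k l ≤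
      n * (ENNReal.ofReal (2 / 3 * b) + ∫⁻ u, ψ u ∂ν) := by
    calc ∑ k ∈ Finset.Icc 1 n, ∑ l ∈ Finset.Icc 1 n, D k l
        = ∑ k ∈ Finset.Icc 1 n, (D k k + ∑ l ∈ (Finset.Icc 1 n).erase k, D k l) :=
          Finset.sum_congr rfl fun k hk => (Finset.add_sum_erase _ _ hk).symm
      _ ≤ ∑ k ∈ Finset.Icc 1 n, (ENNReal.ofReal (2 / 3 * b) +
            ∑ l ∈ (Finset.Icc 1 n).erase k, ∫⁻ ω, ψ |t l ω - t k ω| ∂P) := by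
          refine Finset.sum_le_sum fun k hk => add_le_add ?_ (Finset.sum_le_sum (hoff k hk))
          refine (lintegral_mono fun ω => lintegral_kernelCov_le hX.measurable_X hb _ _).trans ?_
          simp
      _ ≤ _ := by
          rw [Finset.sum_add_distrib, mul_add]
          refine add_le_add (by simp) (sum_lintegral_lag_le ht hstat hψm n)
  have hψint : ∫⁻ u, ψ u ∂ν = ENNReal.ofReal (2 / 3 * b) * ν (Set.Iio u₀) +
      ENNReal.ofReal b * ∫⁻ u in Set.Ici u₀, R u ∂ν := by
    simp only [hψ]
    rw [lintegral_add_left (measurable_const.indicator measurableSet_Iio),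
      lintegral_indicator measurableSet_Iio, setLIntegral_const,
      lintegral_const_mul _ (hR.indicator measurableSet_Ici), lintegral_indicator measurableSet_Ici]
  have hn' : (0 : ℝ) < n := by exact_mod_cast hn
  calc ENNReal.ofReal (n * b) * intVar P (estimator X t a b n)
      ≤ ENNReal.ofReal (n * b) * (ENNReal.ofReal ((1 / (n * b)) ^ 2) *
          (n * (ENNReal.ofReal (2 / 3 * b) + ∫⁻ u, ψ u ∂ν))) := by
        gcongr
        exact (intVar_estimator_le hX h ht hb n).trans (by gcongr)
    _ = ENNReal.ofReal (1 / b) * (ENNReal.ofReal (2 / 3 * b) + ∫⁻ u, ψ u ∂ν) := by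
        rw [← ENNReal.ofReal_natCast n, ← mul_assoc, ← mul_assoc,
          ← ENNReal.ofReal_mul (by positivity), ← ENNReal.ofReal_mul (by positivity)]
        congr 2
        field_simp
    _ = ENNReal.ofReal (1 / b) * ENNReal.ofReal b * (ENNReal.ofReal (2 / 3) +
          ENNReal.ofReal (2 / 3) * ν (Set.Iio u₀) + ∫⁻ u in Set.Ici u₀, R u ∂ν) := by
        rw [hψint, ENNReal.ofReal_mul (by norm_num)]
        ring
    _ = _ := by
        rw [← ENNReal.ofReal_mul (by positivity), one_div, inv_mul_cancel₀ hb.ne',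
          ENNReal.ofReal_one, one_mul]

/-- Asymptotic bound for the integrated variance. -/
lemma exists_mul_intVar_le (hX : HasStationaryDensities P X f f₂) (ht : IndependentTimes P X t)
    {u₀ C : ℝ} (hu₀ : 0 < u₀) (hC : IsDesignConstant P t u₀ C) (hk : PairDensityBound f f₂ u₀)
    {ρ : ℝ} (hρ : 2 < ρ) (hmix : ArithmeticallyMixing P X u₀ ρ) :
    ∃ R : ℝ → ℝ≥0∞, Tendsto R (𝓝[>] 0) (𝓝 0) ∧ ∀ (a b : ℝ) (n : ℕ), 0 < b → 0 < n →
      ENNReal.ofReal (n * b) * intVar P (estimator X t a b n) ≤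
        ENNReal.ofReal (2 / 3 + C) + R b := by
  obtain ⟨htm, hC0, hstat, h0, hνC, A, hA, hνA⟩ := hC.lagMeasure_spec hu₀
  obtain ⟨k, hk0, hkc, hki, hkb⟩ := hk
  obtain ⟨a₀, u₁, ha₀, hu₁, hα⟩ := hmix
  set K := ∫ y, k y with hK
  have hKe : ∫⁻ y, ENNReal.ofReal (k y) = ENNReal.ofReal K :=
    (ofReal_integral_eq_lintegral_ofReal hki (ae_of_all _ fun y => (hk0 y).le)).symm
  -- The remainder depends on the bin width only, hence is uniform in the origin and in the sample
  -- size.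
  refine ⟨fun b => ∫⁻ u in Set.Ici u₀, lagBound K a₀ u₁ ρ b u ∂(lagMeasure P t),
    tendsto_lintegral_lagBound hA hνA ha₀ hρ (hu₀.trans hu₁), fun a b n hb hn => ?_⟩
  refine (mul_intVar_le hX ht htm hstat h0 (u₀ := u₀) hb hn (measurable_lagBound K a₀ u₁ ρ b)
    fun s u hsu hge => ?_).trans ?_
  · unfold lagBound
    rw [mul_min]
    refine le_min ?_ ?_
    · rw [← hKe]
      exact lintegral_kernelCov_le_density hX hsu hkc.measurable (hkb _ hge) hb
    -- No mixing rate is available below `u₁`; there the value `∞` leaves the minimum to the density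
    -- bound.
    · split_ifs with hlt
      · rw [ENNReal.mul_top (ENNReal.ofReal_pos.2 hb).ne']; exact le_top
      · refine (lintegral_kernelCov_le_alphaTwo hX.measurable_X hb s u).trans ?_
        gcongr
        exact hα _ (not_lt.1 hlt)
  · gcongr
    rw [ENNReal.ofReal_add (by norm_num) hC0]
    gcongr
    -- The short lags really cost `2/3 C`; the factor `2/3` is given up to reach the stated
    -- constant.
    calc ENNReal.ofReal (2 / 3) * lagMeasure P t (Set.Iio u₀)
        ≤ 1 * ENNReal.ofReal C := by
          gcongr
          exact ENNReal.ofReal_le_one.2 (by norm_num)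
      _ = _ := one_mul _

end

/-! ### The bias on one cell -/

section

open intervalIntegral

/-- The linear interpolant on `[c, c + b]` of the means of `f` over the intervals of length `b`
centred at `c` and at `c + b`. -/
noncomputable def meanInterp (f : ℝ → ℝ) (c b x : ℝ) : ℝ :=
  ((c + b - x) / b * ∫ y in (c - b / 2)..(c + b / 2), f y) / b +
    ((x - c) / b * ∫ y in (c + b / 2)..(c + 3 * b / 2), f y) / b

lemma meanInterp_add {f g : ℝ → ℝ} (hf : Continuous f) (hg : Continuous g) (c b x : ℝ) :
    meanInterp (fun y => f y + g y) c b x = meanInterp f c b x + meanInterp g c b x := by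
  simp only [meanInterp]
  rw [integral_add (hf.intervalIntegrable _ _) (hg.intervalIntegrable _ _),
    integral_add (hf.intervalIntegrable _ _) (hg.intervalIntegrable _ _)]
  ring

/-- The interpolant is a convex combination of two averages over bins. -/
lemma abs_meanInterp_le {r : ℝ → ℝ} {c b x κ : ℝ} (hb : 0 < b) (hx : x ∈ Set.Icc c (c + b))
    (hr : ∀ y ∈ Set.Icc (c - b / 2) (c + 3 * b / 2), |r y| ≤ κ) :
    |meanInterp r c b x| ≤ κ := by
  have i1 : |∫ y in (c - b / 2)..(c + b / 2), r y| ≤ κ * b := by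
    have := norm_integral_le_of_norm_le_const (a := c - b / 2) (b := c + b / 2) (f := r) (C := κ)
      fun y hy => by
        rw [Set.uIoc_of_le (by linarith)] at hy
        exact hr y ⟨hy.1.le, by linarith [hy.2]⟩
    rwa [show c + b / 2 - (c - b / 2) = b by ring, abs_of_pos hb, Real.norm_eq_abs] at this
  have i2 : |∫ y in (c + b / 2)..(c + 3 * b / 2), r y| ≤ κ * b := by
    have := norm_integral_le_of_norm_le_const (a := c + b / 2) (b := c + 3 * b / 2) (f := r)
      (C := κ) fun y hy => by
        rw [Set.uIoc_of_le (by linarith)] at hy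
        exact hr y ⟨by linarith [hy.1], hy.2⟩
    rwa [show c + 3 * b / 2 - (c + b / 2) = b by ring, abs_of_pos hb, Real.norm_eq_abs] at this
  have w1 : 0 ≤ (c + b - x) / b := div_nonneg (by linarith [hx.2]) hb.le
  have w2 : 0 ≤ (x - c) / b := div_nonneg (by linarith [hx.1]) hb.le
  refine (abs_add_le _ _).trans ?_
  rw [abs_div, abs_div, abs_mul, abs_mul, abs_of_nonneg w1, abs_of_nonneg w2, abs_of_pos hb]
  calc (c + b - x) / b * |∫ y in (c - b / 2)..(c + b / 2), r y| / b +
        (x - c) / b * |∫ y in (c + b / 2)..(c + 3 * b / 2), r y| / b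
      ≤ (c + b - x) / b * (κ * b) / b + (x - c) / b * (κ * b) / b := by gcongr
    _ = κ := by field_simp; ring

lemma integral_quadratic (α β m c u v : ℝ) :
    ∫ y in u..v, (α + β * (y - c) + m / 2 * (y - c) ^ 2) =
      (α * v + β / 2 * (v - c) ^ 2 + m / 6 * (v - c) ^ 3) -
        (α * u + β / 2 * (u - c) ^ 2 + m / 6 * (u - c) ^ 3) := by
  refine integral_eq_sub_of_hasDerivAt
    (f := fun y => α * y + β / 2 * (y - c) ^ 2 + m / 6 * (y - c) ^ 3) (fun y _ => ?_)
    (Continuous.intervalIntegrable (by fun_prop) _ _)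
  have h1 : HasDerivAt (fun y => y - c) 1 y := (hasDerivAt_id y).sub_const c
  have := (((hasDerivAt_id y).const_mul α).add ((h1.pow 2).const_mul (β / 2))).add
    ((h1.pow 3).const_mul (m / 6))
  convert! this using 1
  simp only [Nat.cast_ofNat, Nat.add_one_sub_one]
  ring

/-- Affine functions are reproduced exactly. On the quadratic part, averaging over a bin adds `b ^ 2
m / 24`, and linear interpolation adds `θ (1 - θ) b ^ 2 m / 2` with `θ = (x - c) / b`. -/
lemma meanInterp_quadratic (α β m c x : ℝ) {b : ℝ} (hb : 0 < b) :
    meanInterp (fun y => α + β * (y - c) + m / 2 * (y - c) ^ 2) c b x -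
      (α + β * (x - c) + m / 2 * (x - c) ^ 2) =
      b ^ 2 * (1 / 24 + (x - c) / b * (1 - (x - c) / b) / 2) * m := by
  simp only [meanInterp, integral_quadratic]
  field_simp
  ring

/-- The error of second order Taylor expansion with an arbitrary second order coefficient. -/
lemma abs_taylor_le {f f' f'' : ℝ → ℝ} (hf : ∀ y, HasDerivAt f (f' y) y)
    (hf' : ∀ y, HasDerivAt f' (f'' y) y) (hc : Continuous f'') {c m u v : ℝ}
    (hcuv : c ∈ Set.Icc u v) {y : ℝ} (hy : y ∈ Set.Icc u v) :
    |f y - (f c + f' c * (y - c) + m / 2 * (y - c) ^ 2)| ≤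
      (∫ z in u..v, |f'' z - m|) * |y - c| := by
  set E := ∫ z in u..v, |f'' z - m| with hE
  have hcm : Continuous fun z => f'' z - m := by fun_prop
  have hd : ∀ y ∈ Set.Icc u v, |f' y - f' c - m * (y - c)| ≤ E := by
    intro y hy
    have h1 : ∫ z in c..y, (f'' z - m) = f' y - f' c - m * (y - c) := by
      rw [integral_sub (hc.intervalIntegrable _ _) intervalIntegrable_const,
        integral_eq_sub_of_hasDerivAt (fun z _ => hf' z) (hc.intervalIntegrable _ _),
        intervalIntegral.integral_const, smul_eq_mul]
      ring
    rw [← h1, ← Real.norm_eq_abs]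
    refine (norm_integral_le_abs_integral_norm).trans ?_
    rw [abs_integral_eq_abs_integral_uIoc, abs_of_nonneg (integral_nonneg fun _ => norm_nonneg _),
      hE, integral_of_le (hcuv.1.trans hcuv.2)]
    refine setIntegral_mono_set ?_ (ae_of_all _ fun _ => abs_nonneg _) ?_
    · exact (hcm.abs.integrableOn_Icc).mono_set Set.Ioc_subset_Icc_self
    · have hsub : Set.uIoc c y ⊆ Set.Ioc u v := fun z hz =>
        ⟨(le_min hcuv.1 hy.1).trans_lt hz.1, hz.2.trans (max_le hcuv.2 hy.2)⟩
      exact hsub.eventuallyLE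
  have hder : ∀ y ∈ Set.Icc u v, HasDerivWithinAt
      (fun y => f y - (f c + f' c * (y - c) + m / 2 * (y - c) ^ 2))
      (f' y - f' c - m * (y - c)) (Set.Icc u v) y := by
    intro y _
    have h1 : HasDerivAt (fun y => y - c) 1 y := (hasDerivAt_id y).sub_const c
    have := (hf y).sub (((h1.const_mul (f' c)).const_add (f c)).add ((h1.pow 2).const_mul (m / 2)))
    refine HasDerivAt.hasDerivWithinAt ?_
    convert! this using 1
    simp only [Nat.cast_ofNat, Nat.add_one_sub_one]
    ring
  have := (convex_Icc u v).norm_image_sub_le_of_norm_hasDerivWithin_le hder hd hcuv hy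
  simpa using this

/-- Compare `f` with a quadratic `q` having second derivative `m`. On both bins `|y - c| ≤ 3 b / 2`,
so `|f - q| ≤ 3 / 2 * b * E`; this error enters twice, through the interpolant and through the value
at `x`. The free `m` is later the mean of `f''` over the cell. -/
lemma abs_meanInterp_sub_le {f f' f'' : ℝ → ℝ} (hf : ∀ y, HasDerivAt f (f' y) y)
    (hf' : ∀ y, HasDerivAt f' (f'' y) y) (hc : Continuous f'') {c b x : ℝ} (hb : 0 < b)
    (hx : x ∈ Set.Icc c (c + b)) (m : ℝ) :
    |meanInterp f c b x - f x - b ^ 2 * (1 / 24 + (x - c) / b * (1 - (x - c) / b) / 2) * m| ≤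
      3 * b * ∫ z in (c - b / 2)..(c + 3 * b / 2), |f'' z - m| := by
  set E := ∫ z in (c - b / 2)..(c + 3 * b / 2), |f'' z - m| with hE
  set q : ℝ → ℝ := fun y => f c + f' c * (y - c) + m / 2 * (y - c) ^ 2 with hq
  have hE0 : 0 ≤ E := integral_nonneg (by linarith) fun _ _ => abs_nonneg _
  have hfc : Continuous f := continuous_iff_continuousAt.2 fun y => (hf y).continuousAt
  have hqc : Continuous q := by fun_prop
  have hr : ∀ y ∈ Set.Icc (c - b / 2) (c + 3 * b / 2), |f y - q y| ≤ 3 / 2 * b * E := by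
    intro y hy
    refine (abs_taylor_le hf hf' hc (c := c) ⟨by linarith, by linarith⟩ hy).trans ?_
    rw [mul_comm]
    refine mul_le_mul_of_nonneg_right ?_ hE0
    rw [abs_le]; constructor <;> linarith [hy.1, hy.2]
  have hsplit : meanInterp f c b x = meanInterp q c b x + meanInterp (fun y => f y - q y) c b x := by
    rw [← meanInterp_add hqc (by fun_prop)]
    simp
  rw [← meanInterp_quadratic (f c) (f' c) m c x hb, hsplit]
  have h1 := abs_meanInterp_le hb hx hr
  have h2 := hr x ⟨by linarith [hx.1], by linarith [hx.2]⟩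
  calc |meanInterp q c b x + meanInterp (fun y => f y - q y) c b x - f x - (meanInterp q c b x - q x)|
      = |meanInterp (fun y => f y - q y) c b x - (f x - q x)| := by congr 1; ring
    _ ≤ _ := (abs_sub _ _).trans (by linarith)

/-- In the variable `θ = (x - c) / b`, expanding the square gives `1/576 + 1/144 + 1/120 = 49/2880`.
-/
lemma integral_bernoulli_sq (c : ℝ) {b : ℝ} (hb : 0 < b) :
    ∫ x in c..(c + b), (1 / 24 + (x - c) / b * (1 - (x - c) / b) / 2) ^ 2 = 49 / 2880 * b := by
  rw [integral_comp_sub_right (fun x => (1 / 24 + x / b * (1 - x / b) / 2) ^ 2) c,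
    integral_comp_div (fun x => (1 / 24 + x * (1 - x) / 2) ^ 2) hb.ne', sub_self, zero_div,
    add_sub_cancel_left, div_self hb.ne']
  have : ∫ x in (0 : ℝ)..1, (1 / 24 + x * (1 - x) / 2) ^ 2 = 49 / 2880 := by
    rw [integral_eq_sub_of_hasDerivAt (f := fun x => x / 576 + x ^ 2 / 48 + (1 / 4 - 1 / 24) * x ^ 3 / 3
      - x ^ 4 / 8 + x ^ 5 / 20) (fun x _ => ?_) (Continuous.intervalIntegrable (by fun_prop) _ _)]
    · norm_num
    · have h := ((((hasDerivAt_id x).div_const 576).add ((hasDerivAt_pow 2 x).div_const 48)).add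
        (((hasDerivAt_pow 3 x).const_mul ((1 : ℝ) / 4 - 1 / 24)).div_const 3)).sub
          ((hasDerivAt_pow 4 x).div_const 8) |>.add ((hasDerivAt_pow 5 x).div_const 20)
      convert! h using 1
      simp only [Nat.cast_ofNat, Nat.add_one_sub_one]
      ring
  rw [this, smul_eq_mul, mul_comm]

/-- The mean `m` of `φ` over `[c, c + b]` satisfies `b m ^ 2 ≤ ∫ φ ^ 2`. -/
lemma mul_mean_sq_le {φ : ℝ → ℝ} (hφ : Continuous φ) (c : ℝ) {b : ℝ} (hb : 0 < b) :
    b * ((∫ z in c..(c + b), φ z) / b) ^ 2 ≤ ∫ z in c..(c + b), φ z ^ 2 := by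
  set m := (∫ z in c..(c + b), φ z) / b with hm
  have hI : ∫ z in c..(c + b), φ z = b * m := by rw [hm]; field_simp
  have h0 : 0 ≤ ∫ z in c..(c + b), (φ z - m) ^ 2 :=
    integral_nonneg (by linarith) fun _ _ => sq_nonneg _
  have e : ∫ z in c..(c + b), (φ z - m) ^ 2 =
      (∫ z in c..(c + b), φ z ^ 2) - 2 * m * (∫ z in c..(c + b), φ z) + b * m ^ 2 := by
    have : ∀ z, (φ z - m) ^ 2 = φ z ^ 2 - 2 * m * φ z + m ^ 2 := fun z => by ring
    simp_rw [this]
    rw [integral_add (Continuous.intervalIntegrable (by fun_prop) _ _) intervalIntegrable_const,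
      integral_sub (Continuous.intervalIntegrable (by fun_prop) _ _)
        (Continuous.intervalIntegrable (by fun_prop) _ _), intervalIntegral.integral_const_mul, intervalIntegral.integral_const,
      smul_eq_mul, add_sub_cancel_left]
  rw [e, hI] at h0
  nlinarith

/-- Pointwise bound of the squared bias. -/
lemma sq_meanInterp_sub_le {f f' f'' : ℝ → ℝ} (hf : ∀ y, HasDerivAt f (f' y) y)
    (hf' : ∀ y, HasDerivAt f' (f'' y) y) (hc : Continuous f'') {l₀ ν : ℝ} (hl₀ : 0 ≤ l₀)
    (hν : 0 ≤ ν) (hol : ∀ x y, |f'' x - f'' y| ≤ l₀ * |x - y| ^ ν) {c b x : ℝ} (hb : 0 < b)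
    (hx : x ∈ Set.Icc c (c + b)) :
    (meanInterp f c b x - f x) ^ 2 ≤
      b ^ 4 * ((∫ z in c..(c + b), f'' z) / b) ^ 2 *
        (1 / 24 + (x - c) / b * (1 - (x - c) / b) / 2) ^ 2 +
      66 * l₀ * b ^ 3 * (2 * b) ^ ν * ∫ z in (c - b / 2)..(c + 3 * b / 2), |f'' z| := by
  set m := (∫ z in c..(c + b), f'' z) / b with hm
  set S := ∫ z in (c - b / 2)..(c + 3 * b / 2), |f'' z| with hS
  set E := ∫ z in (c - b / 2)..(c + 3 * b / 2), |f'' z - m| with hE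
  set θ := (x - c) / b with hθ
  have hI : ∫ z in c..(c + b), f'' z = b * m := by rw [hm]; field_simp
  have hm1 : ∀ y ∈ Set.Icc (c - b / 2) (c + 3 * b / 2), |f'' y - m| ≤ l₀ * (2 * b) ^ ν := by
    intro y hy
    have h1 : ∫ z in c..(c + b), (f'' y - f'' z) = b * (f'' y - m) := by
      rw [integral_sub intervalIntegrable_const (hc.intervalIntegrable _ _), intervalIntegral.integral_const, hI,
        smul_eq_mul]; ring
    have h2 := norm_integral_le_of_norm_le_const (a := c) (b := c + b)
      (f := fun z => f'' y - f'' z) (C := l₀ * (2 * b) ^ ν) fun z hz => by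
        rw [Set.uIoc_of_le (by linarith)] at hz
        refine (hol y z).trans ?_
        gcongr
        rw [abs_le]; constructor <;> linarith [hy.1, hy.2, hz.1, hz.2]
    rw [h1, add_sub_cancel_left, Real.norm_eq_abs, abs_mul, abs_of_pos hb, mul_comm] at h2
    exact le_of_mul_le_mul_right h2 hb
  have hE1 : E ≤ 2 * b * (l₀ * (2 * b) ^ ν) := by
    have := norm_integral_le_of_norm_le_const (a := c - b / 2) (b := c + 3 * b / 2)
      (f := fun z => |f'' z - m|) (C := l₀ * (2 * b) ^ ν) fun z hz => by
        rw [Set.uIoc_of_le (by linarith)] at hz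
        rw [Real.norm_eq_abs, abs_abs]
        exact hm1 z ⟨hz.1.le, hz.2⟩
    rw [show c + 3 * b / 2 - (c - b / 2) = 2 * b by ring, abs_of_pos (by linarith : 0 < 2 * b)] at this
    exact (le_abs_self _).trans (this.trans_eq (by ring))
  have hmS : b * |m| ≤ S := by
    calc b * |m| = |∫ z in c..(c + b), f'' z| := by rw [hI, abs_mul, abs_of_pos hb]
      _ ≤ ∫ z in c..(c + b), |f'' z| := abs_integral_le_integral_abs (by linarith)
      _ ≤ S := integral_mono_interval (by linarith) (by linarith) (by linarith)
          (ae_of_all _ fun _ => abs_nonneg _) (hc.abs.intervalIntegrable _ _)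
  have hE0 : 0 ≤ E := integral_nonneg (by linarith) fun _ _ => abs_nonneg _
  have hS0 : 0 ≤ S := integral_nonneg (by linarith) fun _ _ => abs_nonneg _
  have hE2 : E ≤ 3 * S := by
    have h1 : E ≤ ∫ z in (c - b / 2)..(c + 3 * b / 2), (|f'' z| + |m|) :=
      integral_mono_on (by linarith) (Continuous.intervalIntegrable (by fun_prop) _ _)
        (Continuous.intervalIntegrable (by fun_prop) _ _) fun z _ => abs_sub _ _
    rw [integral_add (hc.abs.intervalIntegrable _ _) intervalIntegrable_const, intervalIntegral.integral_const,
      smul_eq_mul] at h1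
    linarith
  have hθ0 : 0 ≤ θ := div_nonneg (by linarith [hx.1]) hb.le
  have hθ1 : θ ≤ 1 := by rw [hθ, div_le_one hb]; linarith [hx.2]
  set B := 1 / 24 + θ * (1 - θ) / 2 with hB
  have hB0 : 0 ≤ B := by
    have : 0 ≤ θ * (1 - θ) := mul_nonneg hθ0 (by linarith)
    rw [hB]; linarith
  have hB1 : B ≤ 1 := by nlinarith [sq_nonneg (θ - 1 / 2)]
  have key := abs_meanInterp_sub_le hf hf' hc hb hx m
  rw [← hE, ← hθ, ← hB] at key
  set e := meanInterp f c b x - f x - b ^ 2 * B * m with he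
  have hsplit : meanInterp f c b x - f x = b ^ 2 * B * m + e := by rw [he]; ring
  have ha : |b ^ 2 * B * m| ≤ b * S := by
    rw [abs_mul, abs_of_nonneg (by positivity : 0 ≤ b ^ 2 * B)]
    calc b ^ 2 * B * |m| ≤ b ^ 2 * 1 * |m| := by gcongr
      _ = b * (b * |m|) := by ring
      _ ≤ b * S := by gcongr
  -- The remainder is bounded twice: by the Hölder condition, which makes it small, and by the local
  -- integral `S` of `|f''|`, which makes it summable over the cells. In the product `e * (2 * main
  -- + e)` the first factor takes the Hölder bound and the second the bound `11 * (b * S)`, whence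
  -- `66 = 6 * 11`.
  have he1 : |e| ≤ 6 * b ^ 2 * (l₀ * (2 * b) ^ ν) :=
    key.trans (by nlinarith [mul_le_mul_of_nonneg_left hE1 hb.le])
  have he2 : |e| ≤ 9 * (b * S) := key.trans (by nlinarith [mul_le_mul_of_nonneg_left hE2 hb.le])
  rw [hsplit]
  calc (b ^ 2 * B * m + e) ^ 2 = b ^ 4 * m ^ 2 * B ^ 2 + e * (2 * (b ^ 2 * B * m) + e) := by ring
    _ ≤ b ^ 4 * m ^ 2 * B ^ 2 + |e| * (2 * |b ^ 2 * B * m| + |e|) := by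
        refine add_le_add le_rfl ((le_abs_self _).trans ?_)
        rw [abs_mul]
        refine mul_le_mul_of_nonneg_left ((abs_add_le _ _).trans ?_) (abs_nonneg _)
        rw [abs_mul 2, abs_two]
    _ ≤ b ^ 4 * m ^ 2 * B ^ 2 + 6 * b ^ 2 * (l₀ * (2 * b) ^ ν) * (2 * (b * S) + 9 * (b * S)) := by
        gcongr
    _ = _ := by ring

/-- The integrated squared bias on one cell. -/
lemma lintegral_sq_meanInterp_sub_le {f f' f'' : ℝ → ℝ} (hf : ∀ y, HasDerivAt f (f' y) y)
    (hf' : ∀ y, HasDerivAt f' (f'' y) y) (hc : Continuous f'') {l₀ ν : ℝ} (hl₀ : 0 ≤ l₀)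
    (hν : 0 ≤ ν) (hol : ∀ x y, |f'' x - f'' y| ≤ l₀ * |x - y| ^ ν) (c : ℝ) {b : ℝ} (hb : 0 < b) :
    ∫⁻ x in Set.Ico c (c + b), ENNReal.ofReal ((meanInterp f c b x - f x) ^ 2) ≤
      ENNReal.ofReal (49 / 2880 * b ^ 4) * (∫⁻ z in Set.Ico c (c + b), ENNReal.ofReal (f'' z ^ 2)) +
      ENNReal.ofReal (66 * l₀ * b ^ 4 * (2 * b) ^ ν) *
        ∫⁻ z in Set.Ico (c - b / 2) (c + 3 * b / 2), ENNReal.ofReal |f'' z| := by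
  have conv : ∀ (φ : ℝ → ℝ) (u v : ℝ), Continuous φ → (∀ z, 0 ≤ φ z) → u ≤ v →
      ∫⁻ z in Set.Ico u v, ENNReal.ofReal (φ z) = ENNReal.ofReal (∫ z in u..v, φ z) := by
    intro φ u v hφ h0 huv
    rw [integral_of_le huv, ← integral_Ico_eq_integral_Ioc,
      ofReal_integral_eq_lintegral_ofReal (hφ.integrableOn_Icc.mono_set Set.Ico_subset_Icc_self)
        (ae_of_all _ h0)]
  set m := (∫ z in c..(c + b), f'' z) / b with hm
  set S := ∫ z in (c - b / 2)..(c + 3 * b / 2), |f'' z| with hS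
  have hS0 : 0 ≤ S := integral_nonneg (by linarith) fun _ _ => abs_nonneg _
  calc ∫⁻ x in Set.Ico c (c + b), ENNReal.ofReal ((meanInterp f c b x - f x) ^ 2)
      ≤ ∫⁻ x in Set.Ico c (c + b), ENNReal.ofReal (b ^ 4 * m ^ 2 *
          (1 / 24 + (x - c) / b * (1 - (x - c) / b) / 2) ^ 2 +
            66 * l₀ * b ^ 3 * (2 * b) ^ ν * S) := by
        refine setLIntegral_mono' measurableSet_Ico fun x hx => ENNReal.ofReal_le_ofReal ?_
        exact sq_meanInterp_sub_le hf hf' hc hl₀ hν hol hb ⟨hx.1, hx.2.le⟩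
    _ = ENNReal.ofReal (49 / 2880 * b ^ 4 * (b * m ^ 2) +
          66 * l₀ * b ^ 4 * (2 * b) ^ ν * S) := by
        rw [conv _ _ _ (by fun_prop) (fun x => by positivity) (by linarith),
          integral_add (Continuous.intervalIntegrable (by fun_prop) _ _) intervalIntegrable_const,
          intervalIntegral.integral_const_mul, integral_bernoulli_sq c hb, intervalIntegral.integral_const, smul_eq_mul]
        congr 1; ring
    _ ≤ ENNReal.ofReal (49 / 2880 * b ^ 4 * (∫ z in c..(c + b), f'' z ^ 2) +
          66 * l₀ * b ^ 4 * (2 * b) ^ ν * S) := by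
        gcongr
        exact mul_mean_sq_le hc c hb
    _ ≤ _ := by
        refine ENNReal.ofReal_add_le.trans ?_
        rw [ENNReal.ofReal_mul (p := 49 / 2880 * b ^ 4) (by positivity),
          ENNReal.ofReal_mul (p := 66 * l₀ * b ^ 4 * (2 * b) ^ ν) (by positivity),
          conv _ _ _ (by fun_prop) (fun z => sq_nonneg _) (by linarith),
          conv _ _ _ (by fun_prop) (fun z => abs_nonneg _) (by linarith)]

end

/-! ### The mean integrated squared error -/

section

variable {Ω : Type*} [MeasurableSpace Ω] {P : Measure Ω}
  {X : ℝ → Ω → ℝ} {t : ℕ → Ω → ℝ} {f : ℝ → ℝ} {f₂ : ℝ → ℝ × ℝ → ℝ}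

lemma measurable_estimator (h : IndependentTimes P X t) (ht : ∀ k, Measurable (t k)) {a b : ℝ}
    (hb : 0 < b) (n : ℕ) : Measurable fun q : Ω × ℝ => estimator X t a b n q.1 q.2 := by
  simp only [estimator, freqPoly_eq hb]
  exact (Finset.measurable_fun_sum _ fun k _ => measurable_polyKernel_of a b measurable_snd
    ((h.measurable_obs ht k).comp measurable_fst)).const_mul _

variable [IsProbabilityMeasure P]

lemma memLp_estimator (h : IndependentTimes P X t) (ht : ∀ k, Measurable (t k)) {a b : ℝ}
    (hb : 0 < b) (n : ℕ) (x : ℝ) : MemLp (fun ω => estimator X t a b n ω x) 2 P := by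
  simp only [estimator, freqPoly_eq hb]
  exact (memLp_finsetSum _ fun k _ => memLp_polyKernel (h.measurable_obs ht k) hb x).const_mul _

/-- The mean of the frequency polygon interpolates the means of `f` over the bins. -/
lemma integral_estimator (hX : HasStationaryDensities P X f f₂) (h : IndependentTimes P X t)
    (ht : ∀ k, Measurable (t k)) {a b : ℝ} (hb : 0 < b) {n : ℕ} (hn : 0 < n) {j : ℤ} {x : ℝ}
    (hx : x ∈ cell a b j) :
    ∫ ω, estimator X t a b n ω x ∂P = meanInterp f (binMid a b j) b x := by
  have hbin : ∀ j : ℤ, ∫ ω, (bin a b j).indicator (fun _ => (1 : ℝ)) (X 0 ω) ∂P =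
      ∫ y in (binLeft a b j)..(binLeft a b (j + 1)), f y := by
    intro j
    rw [intervalIntegral.integral_of_le (by simp only [binLeft]; push_cast; nlinarith),
      ← integral_Ico_eq_integral_Ioc, ← measureReal_preimage hX 0 measurableSet_Ico,
      ← integral_indicator_one (hX.measurable_X 0 measurableSet_Ico)]
    rfl
  have hint : ∀ j : ℤ, Integrable (fun ω => (bin a b j).indicator (fun _ => (1 : ℝ)) (X 0 ω)) P :=
    fun j => (integrable_const (1 : ℝ)).indicator (hX.measurable_X 0 (measurableSet_bin a b j))
  have hmean : ∫ ω, polyKernel a b x (X 0 ω) ∂P =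
      (binMid a b (j + 1) - x) / b * (∫ y in (binLeft a b j)..(binLeft a b (j + 1)), f y) +
      (x - binMid a b j) / b * ∫ y in (binLeft a b (j + 1))..(binLeft a b (j + 1 + 1)), f y := by
    simp_rw [polyKernel_of_mem_cell hb hx]
    rw [integral_add ((hint j).const_mul _) ((hint (j + 1)).const_mul _), integral_const_mul,
      integral_const_mul, hbin, hbin]
  simp only [estimator, freqPoly_eq hb]
  rw [integral_const_mul, integral_finsetSum _ fun k _ =>
    (memLp_polyKernel (h.measurable_obs ht k) hb x).integrable one_le_two]
  simp_rw [integral_polyKernel_obs hX h ht hb]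
  rw [Finset.sum_const, Nat.card_Icc, add_tsub_cancel_right, nsmul_eq_mul, hmean, meanInterp]
  have hn' : (n : ℝ) ≠ 0 := by exact_mod_cast hn.ne'
  have e1 : binMid a b j - b / 2 = binLeft a b j := by rw [binMid_eq, binLeft]; ring
  have e2 : binMid a b j + b / 2 = binLeft a b (j + 1) := by
    rw [binMid_eq, binLeft]; push_cast; ring
  have e3 : binMid a b j + 3 * b / 2 = binLeft a b (j + 1 + 1) := by
    rw [binMid_eq, binLeft]; push_cast; ring
  have e4 : binMid a b (j + 1) = binMid a b j + b := by
    rw [binMid_eq, binMid_eq]; push_cast; ring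
  rw [e1, e2, e3, e4]
  field_simp

lemma tsum_lintegral_bin_le {a b : ℝ} (hb : 0 < b) (i : ℤ) (G : ℝ → ℝ≥0∞) :
    ∑' j, ∫⁻ x in bin a b (j + i), G x ≤ ∫⁻ x, G x := by
  rw [← lintegral_iUnion (fun j => measurableSet_bin a b (j + i)) (pairwise_disjoint_bin_add hb i)]
  exact setLIntegral_le_lintegral _ _

/-- The integrated squared bias. -/
lemma lintegral_sq_bias_le (hX : HasStationaryDensities P X f f₂) (h : IndependentTimes P X t)
    (ht : ∀ k, Measurable (t k)) {f' f'' : ℝ → ℝ} (hf : ∀ y, HasDerivAt f (f' y) y)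
    (hf' : ∀ y, HasDerivAt f' (f'' y) y) (hc : Continuous f'') {l₀ ν : ℝ} (hl₀ : 0 ≤ l₀)
    (hν : 0 ≤ ν) (hol : ∀ x y, |f'' x - f'' y| ≤ l₀ * |x - y| ^ ν) {a b : ℝ} (hb : 0 < b) {n : ℕ}
    (hn : 0 < n) :
    ∫⁻ x, ENNReal.ofReal ((∫ ω, estimator X t a b n ω x ∂P - f x) ^ 2) ≤
      ENNReal.ofReal (49 / 2880 * b ^ 4) * (∫⁻ z, ENNReal.ofReal (f'' z ^ 2)) +
      ENNReal.ofReal (66 * l₀ * b ^ 4 * (2 * b) ^ ν) * (2 * ∫⁻ z, ENNReal.ofReal |f'' z|) := by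
  rw [lintegral_eq_tsum_cell hb (a := a)]
  have hcell : ∀ j, cell a b j = Set.Ico (binMid a b j) (binMid a b j + b) := fun j => by
    rw [cell]; congr 1; rw [binMid_eq, binMid_eq]; push_cast; ring
  -- The error on cell `j` involves `f''` on bins `j` and `j + 1`, so every bin is used by two
  -- cells; this is the factor `2` before `∫ |f''|`.
  have hbins : ∀ j, Set.Ico (binMid a b j - b / 2) (binMid a b j + 3 * b / 2) ⊆
      bin a b (j + 0) ∪ bin a b (j + 1) := by
    intro j y hy
    simp only [binMid_eq, Set.mem_Ico] at hy
    simp only [bin, binLeft, Set.mem_union, Set.mem_Ico, add_zero]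
    push_cast
    rcases lt_or_ge y (a + (j + 1) * b) with hlt | hge
    · exact Or.inl ⟨by linarith, hlt⟩
    · exact Or.inr ⟨hge, by linarith⟩
  calc ∑' j, ∫⁻ x in cell a b j, ENNReal.ofReal ((∫ ω, estimator X t a b n ω x ∂P - f x) ^ 2)
      ≤ ∑' j, (ENNReal.ofReal (49 / 2880 * b ^ 4) *
            (∫⁻ z in cell a b j, ENNReal.ofReal (f'' z ^ 2)) +
          ENNReal.ofReal (66 * l₀ * b ^ 4 * (2 * b) ^ ν) *
            ((∫⁻ z in bin a b (j + 0), ENNReal.ofReal |f'' z|) +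
              ∫⁻ z in bin a b (j + 1), ENNReal.ofReal |f'' z|)) := by
        refine ENNReal.tsum_le_tsum fun j => ?_
        have h1 : ∫⁻ x in cell a b j,
            ENNReal.ofReal ((∫ ω, estimator X t a b n ω x ∂P - f x) ^ 2) =
            ∫⁻ x in cell a b j, ENNReal.ofReal ((meanInterp f (binMid a b j) b x - f x) ^ 2) :=
          setLIntegral_congr_fun (measurableSet_cell a b j) fun x hx => by
            simp only [integral_estimator hX h ht hb hn hx]
        rw [h1, hcell]
        refine (lintegral_sq_meanInterp_sub_le hf hf' hc hl₀ hν hol _ hb).trans ?_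
        gcongr
        exact (lintegral_mono_set (hbins j)).trans (lintegral_union_le _ _ _)
    _ ≤ _ := by
        rw [ENNReal.tsum_add, ENNReal.tsum_mul_left, ENNReal.tsum_mul_left, ENNReal.tsum_add,
          ← lintegral_eq_tsum_cell hb]
        gcongr
        rw [two_mul]
        exact add_le_add (tsum_lintegral_bin_le hb _ _) (tsum_lintegral_bin_le hb _ _)

/-- The mean integrated squared error is at most the integrated variance plus the integrated
squared bias. -/
lemma mise_estimator_le (h : IndependentTimes P X t) (ht : ∀ k, Measurable (t k))
    (hf : Measurable f) {a b : ℝ} (hb : 0 < b) (n : ℕ) :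
    mise P (estimator X t a b n) f ≤ intVar P (estimator X t a b n) +
      ∫⁻ x, ENNReal.ofReal ((∫ ω, estimator X t a b n ω x ∂P - f x) ^ 2) := by
  have hF := measurable_estimator h ht (a := a) hb n
  have hm : Measurable fun q : Ω × ℝ => ENNReal.ofReal ((estimator X t a b n q.1 q.2 - f q.2) ^ 2) :=
    ((hF.sub (hf.comp measurable_snd)).pow_const 2).ennreal_ofReal
  have hmean : Measurable fun x => ∫ ω, estimator X t a b n ω x ∂P :=
    (hF.stronglyMeasurable.integral_prod_left').measurable
  have hbias : Measurable fun x => ENNReal.ofReal ((∫ ω, estimator X t a b n ω x ∂P - f x) ^ 2) :=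
    ((hmean.sub hf).pow_const 2).ennreal_ofReal
  rw [mise, lintegral_lintegral_swap (f := fun ω x =>
    ENNReal.ofReal ((estimator X t a b n ω x - f x) ^ 2)) hm.aemeasurable, intVar,
    ← lintegral_add_right _ hbias]
  refine lintegral_mono fun x => ?_
  have hL := memLp_estimator h ht (a := a) hb n x
  have hL' : MemLp (fun ω => estimator X t a b n ω x - f x) 2 P := hL.sub (memLp_const _)
  rw [← ofReal_variance hL, ← variance_sub_const hL.aestronglyMeasurable (f x),
    ← ENNReal.ofReal_add (variance_nonneg _ _) (sq_nonneg _), variance_eq_sub hL',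
    integral_sub (hL.integrable one_le_two) (integrable_const _),
    ← ofReal_integral_eq_lintegral_ofReal hL'.integrable_sq (ae_of_all _ fun _ => sq_nonneg _)]
  refine ENNReal.ofReal_le_ofReal (le_of_eq ?_)
  simp

lemma limsup_le_of_tendsto {u v : ℕ → ℝ≥0∞} {L : ℝ≥0∞} (huv : ∀ᶠ n in atTop, u n ≤ v n)
    (hv : Tendsto v atTop (𝓝 L)) : limsup u atTop ≤ L :=
  (limsup_le_limsup huv).trans_eq hv.limsup_eq

end

end FreqPolygon

/-! ### The main theorem

Bounding the covariances along all the bins at once (`sum_abs_dep_le_alphaTwo`) makes the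
assumptions on `f ^ (1 - 1 / p)` and on the boundedness of `f` superfluous. -/

open FreqPolygon in
theorem mainTheorem3 {Ω : Type*} [MeasurableSpace Ω] (P : Measure Ω) [IsProbabilityMeasure P]
    (X : ℝ → Ω → ℝ) (f : ℝ → ℝ) (f₂ : ℝ → ℝ × ℝ → ℝ)
    (hX : HasStationaryDensities P X f f₂)
    (t : ℕ → Ω → ℝ) (ht : IndependentTimes P X t)
    (u₀ C : ℝ) (hu₀ : 0 < u₀) (hC : IsDesignConstant P t u₀ C)
    (hf_cont : Continuous f) (hf_bdd : BddAbove (Set.range f))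
    (hk : PairDensityBound f f₂ u₀)
    (ρ : ℝ) (hρ : 2 < ρ) (hmix : ArithmeticallyMixing P X u₀ ρ)
    (p : ℝ) (hp : 1 < p) (hpρ : p < ρ - 1)
    (hfp_smooth : ContDiff ℝ 1 (fun x => f x ^ (1 - 1 / p)))
    (hfp_int : Integrable (fun x => f x ^ (1 - 1 / p)))
    (a : ℕ → ℝ) :
    (∀ h : ℕ → ℝ, Tendsto h atTop (𝓝[>] 0) → Tendsto (fun n : ℕ => n * h n) atTop atTop →
      limsup (fun n : ℕ =>
          ENNReal.ofReal (n * h n) * intVar P (estimator X t (a n) (h n) n)) atTop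
        ≤ ENNReal.ofReal (2 / 3 + C)) ∧
    (ContDiff ℝ 2 f → Integrable (iteratedDeriv 2 f) → MemLp f 2 → MemLp (iteratedDeriv 2 f) 2 →
      (∃ l₀ ν : ℝ, 0 < l₀ ∧ 0 < ν ∧ ν ≤ 1 ∧
        ∀ x y, |iteratedDeriv 2 f x - iteratedDeriv 2 f y| ≤ l₀ * |x - y| ^ ν) →
      ∀ c : ℝ, 0 < c →
        limsup (fun n : ℕ => ENNReal.ofReal ((n : ℝ) ^ (4 / 5 : ℝ)) *
            mise P (estimator X t (a n) (c * (n : ℝ) ^ (-(1 / 5) : ℝ)) n) f) atTop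
          ≤ ENNReal.ofReal (49 / 2880 * c ^ 4 * roughness (iteratedDeriv 2 f) +
              1 / c * (2 / 3 + C))) := by
  obtain ⟨R, hR, hIV⟩ := exists_mul_intVar_le hX ht hu₀ hC hk hρ hmix
  obtain ⟨htm, hC0, -⟩ := hC.lagMeasure_spec hu₀
  refine ⟨fun h hh _ => ?_, fun hf2 hf2i _ hf2L hhol c hc => ?_⟩
  · have hpos : ∀ᶠ n in atTop, 0 < h n := hh self_mem_nhdsWithin
    refine limsup_le_of_tendsto (v := fun n => ENNReal.ofReal (2 / 3 + C) + R (h n)) ?_ ?_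
    · filter_upwards [hpos, eventually_gt_atTop 0] with n hn hn0
      exact hIV (a n) (h n) n hn hn0
    · simpa using (hR.comp hh).const_add (ENNReal.ofReal (2 / 3 + C))
  · obtain ⟨l₀, ν, hl₀, hν, -, hol⟩ := hhol
    have hd1 : ∀ y, HasDerivAt f (deriv f y) y := fun y =>
      ((hf2.differentiable (by norm_num)) y).hasDerivAt
    have hd2 : ∀ y, HasDerivAt (deriv f) (iteratedDeriv 2 f y) y := fun y => by
      rw [iteratedDeriv_succ, iteratedDeriv_one]
      have : ContDiff ℝ 1 (deriv f) := hf2.deriv'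
      exact ((this.differentiable (by norm_num)) y).hasDerivAt
    have hcont : Continuous (iteratedDeriv 2 f) := hf2.continuous_iteratedDeriv 2 le_rfl
    set f'' := iteratedDeriv 2 f with hf''
    set b : ℕ → ℝ := fun n => c * (n : ℝ) ^ (-(1 / 5) : ℝ) with hb
    have hb0 : Tendsto b atTop (𝓝 0) := by
      have := ((tendsto_rpow_neg_atTop (by norm_num : (0 : ℝ) < 1 / 5)).comp
        tendsto_natCast_atTop_atTop).const_mul c
      rw [mul_zero] at this
      exact this
    have hbpos : ∀ n : ℕ, 0 < n → 0 < b n := fun n hn => by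
      have : (0 : ℝ) < n := by exact_mod_cast hn
      simp only [hb]; positivity
    have hbw : Tendsto b atTop (𝓝[>] 0) := tendsto_nhdsWithin_iff.2
      ⟨hb0, (eventually_gt_atTop 0).mono hbpos⟩
    set I := ∫⁻ z, ENNReal.ofReal |f'' z| with hI
    have hItop : I ≠ ∞ := by
      have := hf2i.abs.lintegral_lt_top
      exact this.ne
    have hrough : ∫⁻ z, ENNReal.ofReal (f'' z ^ 2) = ENNReal.ofReal (roughness f'') :=
      (ofReal_integral_eq_lintegral_ofReal hf2L.integrable_sq (ae_of_all _ fun _ => sq_nonneg _)).symm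
    have hrough0 : 0 ≤ roughness f'' := integral_nonneg fun _ => sq_nonneg _
    refine limsup_le_of_tendsto (v := fun n => ENNReal.ofReal (1 / c) *
      (ENNReal.ofReal (2 / 3 + C) + R (b n)) +
        (ENNReal.ofReal (49 / 2880 * c ^ 4) * ENNReal.ofReal (roughness f'') +
          ENNReal.ofReal (66 * l₀ * c ^ 4 * (2 * b n) ^ ν) * (2 * I))) ?_ ?_
    · filter_upwards [eventually_gt_atTop 0] with n hn
      have hn' : (0 : ℝ) < n := by exact_mod_cast hn
      have hbn := hbpos n hn
      -- With this bin width, `n ^ (4/5)` equals both `n b / c` and `c ^ 4 / b ^ 4`, so it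
      -- normalizes the variance and the squared bias at once.
      have e1 : (n : ℝ) ^ (4 / 5 : ℝ) = 1 / c * (n * b n) := by
        have : (n : ℝ) ^ (4 / 5 : ℝ) = n * (n : ℝ) ^ (-(1 / 5) : ℝ) := by
          rw [← Real.rpow_one_add' hn'.le (by norm_num)]; norm_num
        rw [this]; simp only [hb]; field_simp
      have e2 : (n : ℝ) ^ (4 / 5 : ℝ) * b n ^ 4 = c ^ 4 := by
        simp only [hb]
        rw [mul_pow, ← Real.rpow_natCast ((n : ℝ) ^ (-(1 / 5) : ℝ)), ← Real.rpow_mul hn'.le,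
          mul_left_comm, ← Real.rpow_add hn']
        norm_num
      have hpow : (0 : ℝ) ≤ (n : ℝ) ^ (4 / 5 : ℝ) := by positivity
      calc ENNReal.ofReal ((n : ℝ) ^ (4 / 5 : ℝ)) * mise P (estimator X t (a n) (b n) n) f
          ≤ ENNReal.ofReal ((n : ℝ) ^ (4 / 5 : ℝ)) * (intVar P (estimator X t (a n) (b n) n) +
              (ENNReal.ofReal (49 / 2880 * b n ^ 4) * ENNReal.ofReal (roughness f'') +
                ENNReal.ofReal (66 * l₀ * b n ^ 4 * (2 * b n) ^ ν) * (2 * I))) := by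
            gcongr
            refine (mise_estimator_le ht htm hX.measurable_f hbn n).trans ?_
            gcongr
            rw [← hrough]
            exact lintegral_sq_bias_le hX ht htm hd1 hd2 hcont hl₀.le hν.le hol hbn hn
        _ = ENNReal.ofReal (1 / c) *
              (ENNReal.ofReal (n * b n) * intVar P (estimator X t (a n) (b n) n)) +
            (ENNReal.ofReal (49 / 2880 * c ^ 4) * ENNReal.ofReal (roughness f'') +
              ENNReal.ofReal (66 * l₀ * c ^ 4 * (2 * b n) ^ ν) * (2 * I)) := by
            rw [← mul_assoc (ENNReal.ofReal (1 / c)),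
              ← ENNReal.ofReal_mul (p := 1 / c) (by positivity), ← e1,
              ← e2, mul_left_comm (49 / 2880 : ℝ),
              show 66 * l₀ * ((n : ℝ) ^ (4 / 5 : ℝ) * b n ^ 4) * (2 * b n) ^ ν =
                (n : ℝ) ^ (4 / 5 : ℝ) * (66 * l₀ * b n ^ 4 * (2 * b n) ^ ν) by ring,
              ENNReal.ofReal_mul hpow, ENNReal.ofReal_mul hpow]
            ring
        _ ≤ _ := by
            gcongr
            exact hIV (a n) (b n) n hbn hn
    · have h1 : Tendsto (fun n => ENNReal.ofReal (1 / c) *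
          (ENNReal.ofReal (2 / 3 + C) + R (b n))) atTop
          (𝓝 (ENNReal.ofReal (1 / c) * ENNReal.ofReal (2 / 3 + C))) := by
        refine ENNReal.Tendsto.const_mul ?_ (Or.inr ENNReal.ofReal_ne_top)
        simpa using (hR.comp hbw).const_add (ENNReal.ofReal (2 / 3 + C))
      have h2 : Tendsto (fun n => ENNReal.ofReal (66 * l₀ * c ^ 4 * (2 * b n) ^ ν) * (2 * I))
          atTop (𝓝 0) := by
        have h3 : Tendsto (fun n => 66 * l₀ * c ^ 4 * (2 * b n) ^ ν) atTop (𝓝 0) := by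
          have := ((hb0.const_mul 2).rpow_const (p := ν) (Or.inr hν.le)).const_mul
            (66 * l₀ * c ^ 4)
          simpa [Real.zero_rpow hν.ne'] using this
        have h4 := ENNReal.Tendsto.mul_const (b := 2 * I) (ENNReal.tendsto_ofReal h3)
          (Or.inr (ENNReal.mul_ne_top (by simp) hItop))
        simpa using h4
      have h5 := h1.add (h2.const_add
        (ENNReal.ofReal (49 / 2880 * c ^ 4) * ENNReal.ofReal (roughness f'')))
      convert! h5 using 2
      rw [add_zero, ← ENNReal.ofReal_mul (by positivity), ← ENNReal.ofReal_mul (by positivity),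
        ← ENNReal.ofReal_add (by positivity) (by positivity), add_comm]
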